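/- **Model.** Two sellers $i=1,2$ with zero marginal cost post prices $p_1,p_2\in\mathbb R$, which a unit mass of consumers observe. A consumer's match values $u_1,u_2$ are independent and uniform on $[0,1]$; buying from seller $i$ yields $u_i-p_i$, the outside option yields $0$. The first inspection is free, inspecting the second seller costs $s>0$, recall is free, and consumers stop optimally: with $V(p)=\mathbb E[\max\{0,u-p\}]$, a consumer who first inspected seller $i$ goes on to inspect seller $j$ iff $V\big(p_j+\max\{0,u_i-p_i\}\big)\ge s$, and then takes the best available option. Let $D_i^1,D_i^2$ be the demand of seller $i$ when ranked first, resp. second, at prices $(p_1,p_2)$, and $\pi_i^n=p_iD_i^n$. A contract is a triple $(p_1,p_2,\alpha)$, where $\alpha\in[0,1]$ is the probability that seller $1$ is ranked first; profits are $\Pi_1=\alpha\pi_1^1+(1-\alpha)\pi_1^2$ and $\Pi_2=\alpha\pi_2^2+(1-\alpha)\pi_2^1$. The contract is *implementable* if no seller gains by charging another price and being ranked second: $\max_{p_1'}\pi_1^2(p_1',p_2)\le\Pi_1$ and $\max_{p_2'}\pi_2^2(p_1,p_2')\le\Pi_2$. Let $P$ be the set of price vectors $(p_1,p_2)$ for which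 some $(p_1,p_2,\alpha)$ is implementable. A *seller-optimal* contract maximizes the industry profit $\Pi_1+\Pi_2$ over all implementable contracts; a *first best* (of a multiproduct seller) maximizes $\Pi_1+\Pi_2$ over all $(p_1,p_2)\in\mathbb R^2$, $\alpha\in[0,1]$. Let $A$ be defined by $V(A)=s$. The search cost is small enough ($A$ large enough), in the sense of the *nondegenerate case*, if $p_1\le A$ and $p_2\le A$ for all $(p_1,p_2)\in P$. **Theorem.** The nondegenerate case obtains for all sufficiently small $s>0$. For every $s>0$ for which it obtains, the set $\{p:(p,p)\in\partial P\}$ has a greatest element $\bar p$, and, with $p^*=\sqrt3/3$: 1. if $\bar p\le p^*$, then $(\bar p,\bar p,1/2)$ is the unique seller-optimal contract; 2. if $\bar p>p^*$, then a seller-optimal contract exists, and every seller-optimal contract $(p_1,p_2,\alpha)$ is asymmetric: $p_1\ne p_2$ and $\alpha\ne 1/2$; 3. in both cases a first best exists, and no first best is implementable. -/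

import Mathlib

open MeasureTheory Set

noncomputable section

namespace OrderedSearch

/-- The law of one match value: uniform on `[0, 1]`. -/
def matchLaw : Measure ℝ := volume.restrict (Icc (0 : ℝ) 1)

/-- `V(p) = E[max {0, u - p}]`, the expected surplus of an opportunity to buy at price `p`. -/
def searchValue (p : ℝ) : ℝ := ∫ u, max 0 (u - p) ∂matchLaw

/-- Optimal stopping of a consumer with search cost `s`, who has inspected (for free) a seller with
price `p` and found the match value `u` there. Her best payoff so far is `max 0 (u - p)`. She
inspects the other seller, whose price is `q`, exactly when the expected gain
`E[max {max 0 (u - p), u' - q}] - max 0 (u - p) = V (q + max 0 (u - p))` covers the cost `s`. -/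
def Continues (s p q u : ℝ) : Prop := s ≤ searchValue (q + max 0 (u - p))

/-- With match values `x.1` at the seller inspected first (price `p`) and `x.2` at the other one
(price `q`), the consumer buys from the seller inspected first. -/
def BuysFirst (s p q : ℝ) (x : ℝ × ℝ) : Prop :=
  0 ≤ x.1 - p ∧ (¬ Continues s p q x.1 ∨ x.2 - q ≤ x.1 - p)

/-- With match values `x.1` at the seller inspected first (price `p`) and `x.2` at the other one
(price `q`), the consumer goes on to inspect the other seller and buys there. -/
def BuysSecond (s p q : ℝ) (x : ℝ × ℝ) : Prop :=
  Continues s p q x.1 ∧ 0 ≤ x.2 - q ∧ x.1 - p < x.2 - q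

/-- Demand of the seller ranked first, with price `p`, when the seller ranked second has price
`q`; the two match values are independent. -/
def demandFirst (s p q : ℝ) : ℝ := (matchLaw.prod matchLaw).real {x | BuysFirst s p q x}

/-- Demand of the seller ranked second, with price `q`, when the seller ranked first has price
`p`. -/
def demandSecond (s p q : ℝ) : ℝ := (matchLaw.prod matchLaw).real {x | BuysSecond s p q x}

/-- A contract: a price for each seller and the probability that seller 1 is ranked first. -/
@[ext]
structure Contract where
  price₁ : ℝ
  price₂ : ℝ
  prob : ℝ

/-- Expected profit of seller 1 (marginal costs are zero). -/
def profit₁ (s : ℝ) (c : Contract) : ℝ :=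
  c.prob * (c.price₁ * demandFirst s c.price₁ c.price₂) +
    (1 - c.prob) * (c.price₁ * demandSecond s c.price₂ c.price₁)

/-- Expected profit of seller 2. -/
def profit₂ (s : ℝ) (c : Contract) : ℝ :=
  c.prob * (c.price₂ * demandSecond s c.price₁ c.price₂) +
    (1 - c.prob) * (c.price₂ * demandFirst s c.price₂ c.price₁)

/-- Industry profit. -/
def industryProfit (s : ℝ) (c : Contract) : ℝ := profit₁ s c + profit₂ s c

/-- The incentive constraints: no seller gains by charging any other price and then being ranked
second with probability one. -/
def Implementable (s : ℝ) (c : Contract) : Prop :=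
  c.prob ∈ Icc (0 : ℝ) 1 ∧
    (∀ p : ℝ, p * demandSecond s c.price₂ p ≤ profit₁ s c) ∧
    (∀ p : ℝ, p * demandSecond s c.price₁ p ≤ profit₂ s c)

/-- The set `P` of implementable price vectors. -/
def implementablePrices (s : ℝ) : Set (ℝ × ℝ) :=
  {p | ∃ α : ℝ, Implementable s ⟨p.1, p.2, α⟩}

/-- The search cost is small enough (`A` is large enough) for the nondegenerate case: no
implementable price exceeds the reservation value `A`, which is defined by `V(A) = s`. -/
def Nondegenerate (s : ℝ) : Prop :=
  ∃ A : ℝ, searchValue A = s ∧ ∀ p ∈ implementablePrices s, p.1 ≤ A ∧ p.2 ≤ A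

/-- The contract maximizes industry profit among all implementable contracts. -/
def IsSellerOptimal (s : ℝ) (c : Contract) : Prop :=
  Implementable s c ∧ ∀ d : Contract, Implementable s d → industryProfit s d ≤ industryProfit s c

/-- The contract is a first best of a multiproduct seller: it maximizes industry profit over all
prices and all `α ∈ [0, 1]`, without incentive constraints. -/
def IsFirstBest (s : ℝ) (c : Contract) : Prop :=
  c.prob ∈ Icc (0 : ℝ) 1 ∧
    ∀ d : Contract, d.prob ∈ Icc (0 : ℝ) 1 → industryProfit s d ≤ industryProfit s c

end OrderedSearch

end

open OrderedSearch

/-!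
Write `A` for the reservation value, `a = 1 - A`, `D₂(p, x)` for the demand of a second seller with
price `x` after a first seller with price `p`, and `m(p) = max_x x D₂(p, x)` for the best deviation
profit against `p`. If all prices are in `[0, A]`, then

* total demand at `(p, q)` is `1 - p q`, whatever the order, since only the consumers with match
  values below both prices do not buy;
* moving a seller from the second to the first position shifts the same number
  `rankGain A p q > 0` of buyers for both sellers.

Hence the demands `X₁, X₂` in a contract satisfy `X₁ + X₂ = 1 - p q`, the incentive constraints are
`m(q) ≤ p X₁` and `m(p) ≤ q X₂`, and `(p, q)` is implementable iff
`p m(p) + q m(q) ≤ p q (1 - p q)` (`exists_implementable_iff`). On the diagonal, this says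
`2 m(p) ≤ p (1 - p²)`, and the industry profit is `p (1 - p²)`, which increases up to `√3 / 3` and
decreases afterwards. Implementable contracts form a compact set, which yields the largest symmetric
price `b` and the existence of optimal contracts.

*Nondegeneracy.* A price above `A` sells only in the first position, to fewer than `a` consumers,
which is less than a deviation earns if `a` is small. Conversely, explicit contracts with a price
above `A` show that nondegeneracy forces `√3 / 3 < A`, so the incentive constraints bind at `b`
whenever `b ≤ √3 / 3`.

*The case `b ≤ √3 / 3`.* The key fact is that the harmonic mean of an implementable pair is an
implementable symmetric price (`harmonicMean_mem`), hence is at most `b`. It holds because, in the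
range of implementable prices, the best deviation against `p` leaves some consumers with the first
seller (`le_of_mem_implementablePrices`); there `m` is a supremum of increasing affine functions of
`p`. If `p < q`, the cheaper seller must earn `m(q)`. When `b ≤ q` this exceeds half of the profit
at the harmonic mean, which pins down a share of demand for the cheaper seller that is so large that
the industry earns less than at the harmonic mean. When `q < b` it suffices to compare with the
symmetric price `q`. See `industryProfit_lt_of_lt`.

*The case `√3 / 3 < b`.* As `m` increases and `p (1 - p²)` decreases beyond `√3 / 3`, the incentive
constraints are slack at `√3 / 3`. Spreading the prices around this point and ranking the more
expensive seller first more often is then implementable and a gain of first order. Contracts with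
equal prices or with probability `1 / 2` earn at most the profit at `√3 / 3`.

*The first best.* It has different prices, hence a deterministic order. If it were implementable,
the price of the second seller would be a best reply to the first one, but an increase would benefit
the first seller without a loss of first order to the second one (`not_both_optimal`). The
demand has a concave kink where the second price starts to make every consumer go on, and there the
industry profit has a convex kink, so that no optimum is located at the kink.
-/

namespace OrderedSearch

/-! ### The search value and the stopping rule -/

instance : IsProbabilityMeasure matchLaw := ⟨by simp [matchLaw]⟩

lemma integral_matchLaw (f : ℝ → ℝ) : ∫ u, f u ∂matchLaw = ∫ u in (0 : ℝ)..1, f u := by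
  rw [matchLaw, integral_Icc_eq_integral_Ioc, intervalIntegral.integral_of_le zero_le_one]

lemma searchValue_of_nonpos {y : ℝ} (hy : y ≤ 0) : searchValue y = 1 / 2 - y := by
  rw [searchValue, integral_matchLaw,
    intervalIntegral.integral_congr (g := fun u => u - y)]
  · rw [intervalIntegral.integral_sub (by simp) (by simp)]
    simp
  · intro u hu
    rw [uIcc_of_le zero_le_one] at hu
    exact max_eq_right (by linarith [hu.1])

lemma searchValue_of_one_le {y : ℝ} (hy : 1 ≤ y) : searchValue y = 0 := by
  rw [searchValue, integral_matchLaw,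
    intervalIntegral.integral_congr (g := fun _ => (0 : ℝ))]
  · simp
  · intro u hu
    rw [uIcc_of_le zero_le_one] at hu
    exact max_eq_left (by linarith [hu.2])

lemma searchValue_of_mem_Icc {y : ℝ} (hy : y ∈ Icc (0 : ℝ) 1) :
    searchValue y = (1 - y) ^ 2 / 2 := by
  have hc : Continuous fun u : ℝ => max 0 (u - y) := by fun_prop
  rw [searchValue, integral_matchLaw,
    ← intervalIntegral.integral_add_adjacent_intervals (b := y)
      (hc.intervalIntegrable _ _) (hc.intervalIntegrable _ _),
    intervalIntegral.integral_congr (g := fun _ => (0 : ℝ)) (b := y),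
    intervalIntegral.integral_congr (g := fun u => u - y) (a := y)]
  · rw [intervalIntegral.integral_sub (by simp) (by simp)]
    simp
    ring
  · intro u hu
    rw [uIcc_of_le hy.2] at hu
    exact max_eq_right (by linarith [hu.1])
  · intro u hu
    rw [uIcc_of_le hy.1] at hu
    exact max_eq_left (by linarith [hu.2])

lemma searchValue_lt_of_lt {x y : ℝ} (hx : x < 1) (hxy : x < y) :
    searchValue y < searchValue x := by
  rcases le_total x 0 with h0 | h0
  · rw [searchValue_of_nonpos h0]
    rcases le_total y 0 with h1 | h1
    · rw [searchValue_of_nonpos h1]; linarith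
    · rcases le_total y 1 with h2 | h2
      · rw [searchValue_of_mem_Icc ⟨h1, h2⟩]; nlinarith
      · rw [searchValue_of_one_le h2]; linarith
  · rw [searchValue_of_mem_Icc ⟨h0, hx.le⟩]
    rcases le_total y 1 with h2 | h2
    · rw [searchValue_of_mem_Icc ⟨h0.trans hxy.le, h2⟩]; nlinarith
    · rw [searchValue_of_one_le h2]; nlinarith

lemma le_searchValue_iff {s A : ℝ} (hs : 0 < s) (hA : searchValue A = s) (y : ℝ) :
    s ≤ searchValue y ↔ y ≤ A := by
  have hA1 : A < 1 := by
    by_contra! h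
    rw [searchValue_of_one_le h] at hA
    exact hs.ne hA
  constructor
  · intro h
    by_contra! hy
    have := searchValue_lt_of_lt hA1 hy
    linarith
  · intro h
    rcases h.eq_or_lt with rfl | h
    · exact hA.ge
    · rw [← hA]
      exact (searchValue_lt_of_lt (h.trans hA1) h).le

/-! ### Demands -/

lemma real_matchLaw_eq_of_Ioi_subset {b : ℝ} (hb : b ∈ Icc (0 : ℝ) 1) {t : Set ℝ}
    (h₁ : Ioi b ⊆ t) (h₂ : t ⊆ Ici b) : matchLaw.real t = 1 - b := by
  have e₁ : matchLaw.real (Ioi b) = 1 - b := by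
    have : Ioi b ∩ Icc (0 : ℝ) 1 = Ioc b 1 := by
      ext v
      simp only [mem_inter_iff, mem_Ioi, mem_Icc, mem_Ioc]
      exact ⟨fun h => ⟨h.1, h.2.2⟩, fun h => ⟨h.1, by linarith [hb.1, h.1], h.2⟩⟩
    rw [matchLaw, measureReal_restrict_apply measurableSet_Ioi, this]
    simp [hb.2]
  have e₂ : matchLaw.real (Ici b) = 1 - b := by
    have : Ici b ∩ Icc (0 : ℝ) 1 = Icc b 1 := by
      ext v
      simp only [mem_inter_iff, mem_Ici, mem_Icc]
      exact ⟨fun h => ⟨h.1, h.2.2⟩, fun h => ⟨h.1, by linarith [hb.1, h.1], h.2⟩⟩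
    rw [matchLaw, measureReal_restrict_apply measurableSet_Ici, this]
    simp [hb.2]
  exact le_antisymm (e₂ ▸ measureReal_mono h₂) (e₁ ▸ measureReal_mono h₁)

lemma real_matchLaw_prod_eq_integral {S : Set (ℝ × ℝ)} (hS : MeasurableSet S) {g : ℝ → ℝ}
    (hg : ∀ u ∈ Icc (0 : ℝ) 1, matchLaw.real (Prod.mk u ⁻¹' S) = g u) :
    (matchLaw.prod matchLaw).real S = ∫ u, g u ∂matchLaw := by
  rw [measureReal_def, Measure.prod_apply hS, ← integral_toReal]
  · exact setIntegral_congr_fun measurableSet_Icc hg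
  · exact (measurable_measure_prodMk_left hS).aemeasurable
  · exact Filter.Eventually.of_forall fun u => measure_lt_top _ _

lemma buysSecond_iff {s A : ℝ} (hs : 0 < s) (hA : searchValue A = s) (p q : ℝ) (x : ℝ × ℝ) :
    BuysSecond s p q x ↔ q + max 0 (x.1 - p) ≤ A ∧ 0 ≤ x.2 - q ∧ x.1 - p < x.2 - q := by
  rw [BuysSecond, Continues, le_searchValue_iff hs hA]

lemma buysFirst_iff {s A : ℝ} (hs : 0 < s) (hA : searchValue A = s) (p q : ℝ) (x : ℝ × ℝ) :
    BuysFirst s p q x ↔ 0 ≤ x.1 - p ∧ (A < q + max 0 (x.1 - p) ∨ x.2 - q ≤ x.1 - p) := by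
  rw [BuysFirst, Continues, le_searchValue_iff hs hA, not_le]

lemma measurableSet_buysSecond {s A : ℝ} (hs : 0 < s) (hA : searchValue A = s) (p q : ℝ) :
    MeasurableSet {x | BuysSecond s p q x} := by
  simp only [buysSecond_iff hs hA]
  have h₁ : MeasurableSet {x : ℝ × ℝ | q + max 0 (x.1 - p) ≤ A} :=
    measurableSet_le (by fun_prop) (by fun_prop)
  have h₂ : MeasurableSet {x : ℝ × ℝ | 0 ≤ x.2 - q} :=
    measurableSet_le (by fun_prop) (by fun_prop)
  have h₃ : MeasurableSet {x : ℝ × ℝ | x.1 - p < x.2 - q} :=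
    measurableSet_lt (by fun_prop) (by fun_prop)
  exact h₁.inter (h₂.inter h₃)

/-- Closed form of the demand of the seller ranked second, at price `x`, when the seller ranked
first charges `p`, for `p ∈ [0, 1]` and `x ∈ [0, A]`. A consumer with match value `u` at the first
seller goes on to the second one when `u - p ≤ A - x`, so the gain `u - p` over the outside option
of those who go on with a positive payoff at hand ranges over `[0, min (1 - p) (A - x)]`. -/
noncomputable def secondDemand (A p x : ℝ) : ℝ :=
  p * (1 - x) + (1 - x) * min (1 - p) (A - x) - min (1 - p) (A - x) ^ 2 / 2

lemma demandSecond_eq {s A p x : ℝ} (hs : 0 < s) (hA : searchValue A = s) (hA1 : A ≤ 1)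
    (hp : p ∈ Icc (0 : ℝ) 1) (hx : x ∈ Icc 0 A) :
    demandSecond s p x = secondDemand A p x := by
  obtain ⟨hp0, hp1⟩ := hp
  obtain ⟨hx0, hxA⟩ := hx
  set T := min (1 - p) (A - x) with hT
  have hT0 : 0 ≤ T := le_min (by linarith) (by linarith)
  have hT1 : T ≤ 1 - p := min_le_left _ _
  have hTA : T ≤ A - x := min_le_right _ _
  have hi₁ : Integrable ((Icc 0 p).indicator fun _ => 1 - x) matchLaw :=
    (integrable_const _).indicator measurableSet_Icc
  have hf : Integrable (fun u => 1 - x - (u - p)) matchLaw := by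
    have : Continuous fun u : ℝ => 1 - x - (u - p) := by fun_prop
    exact this.integrableOn_Icc
  have hi₂ : Integrable ((Ioc p (p + T)).indicator fun u => 1 - x - (u - p)) matchLaw :=
    hf.indicator measurableSet_Ioc
  rw [demandSecond, real_matchLaw_prod_eq_integral (measurableSet_buysSecond hs hA p x)
    (g := fun u => (Icc 0 p).indicator (fun _ => 1 - x) u +
      (Ioc p (p + T)).indicator (fun u => 1 - x - (u - p)) u), integral_add hi₁ hi₂,
    integral_indicator measurableSet_Icc, integral_indicator measurableSet_Ioc, matchLaw,
    Measure.restrict_restrict measurableSet_Icc, Measure.restrict_restrict measurableSet_Ioc,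
    inter_eq_left.mpr (Icc_subset_Icc_right hp1), inter_eq_left.mpr (Ioc_subset_Icc_self.trans
      (Icc_subset_Icc hp0 (by linarith))), ← intervalIntegral.integral_of_le (by linarith)]
  · rw [intervalIntegral.integral_congr (g := fun u => (1 - x + p) - u) fun u _ => by ring,
      intervalIntegral.integral_sub (by simp) (by simp)]
    simp [hp0, secondDemand, ← hT]
    ring
  · rintro u ⟨hu0, hu1⟩
    simp only [preimage_ofPred_eq, buysSecond_iff hs hA]
    rcases le_or_gt u p with hup | hup
    · rw [indicator_of_mem (show u ∈ Icc 0 p from ⟨hu0, hup⟩),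
        indicator_of_notMem (fun h => absurd h.1 (not_lt.mpr hup)), add_zero]
      refine real_matchLaw_eq_of_Ioi_subset ⟨hx0, by linarith⟩ (fun v hv => ?_) (fun v hv => ?_)
      · rw [mem_Ioi] at hv
        refine ⟨?_, by linarith, by linarith⟩
        rw [max_eq_left (by linarith)]
        linarith
      · exact sub_nonneg.mp hv.2.1
    · rw [indicator_of_notMem (fun h => absurd h.2 (not_le.mpr hup)), zero_add]
      rcases le_or_gt u (p + T) with huT | huT
      · rw [indicator_of_mem (show u ∈ Ioc p (p + T) from ⟨hup, huT⟩)]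
        rw [real_matchLaw_eq_of_Ioi_subset (b := x + (u - p)) ⟨by linarith, by linarith⟩]
        · ring
        · intro v hv
          rw [mem_Ioi] at hv
          refine ⟨?_, by linarith, by linarith⟩
          rw [max_eq_right (by linarith)]
          linarith
        · intro v hv
          have := hv.2.2
          rw [mem_Ici]
          linarith
      · rw [indicator_of_notMem (fun h => absurd h.2 (not_le.mpr huT))]
        have hAu : A - x < u - p := by
          rcases min_choice (1 - p) (A - x) with h | h <;> rw [← hT] at h <;> linarith
        convert measureReal_empty
        refine eq_empty_of_forall_notMem fun v hv => ?_
        have h₁ := hv.1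
        have h₂ := le_max_right 0 (u - p)
        linarith

lemma demandSecond_nonneg (s p q : ℝ) : 0 ≤ demandSecond s p q := measureReal_nonneg

lemma demandFirst_nonneg (s p q : ℝ) : 0 ≤ demandFirst s p q := measureReal_nonneg

lemma demandSecond_of_lt {s A p q : ℝ} (hs : 0 < s) (hA : searchValue A = s) (hq : A < q) :
    demandSecond s p q = 0 := by
  rw [demandSecond]
  convert measureReal_empty
  refine eq_empty_of_forall_notMem fun x hx => ?_
  have h₁ := ((buysSecond_iff hs hA p q x).mp hx).1
  have h₂ := le_max_left 0 (x.1 - p)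
  linarith

lemma demandSecond_mono {s A p p' : ℝ} (hs : 0 < s) (hA : searchValue A = s) (hp : p ≤ p')
    (q : ℝ) : demandSecond s p q ≤ demandSecond s p' q := by
  refine measureReal_mono fun x hx => ?_
  rw [mem_ofPred_eq, buysSecond_iff hs hA] at hx ⊢
  refine ⟨le_trans (by gcongr) hx.1, hx.2.1, by linarith [hx.2.2]⟩

lemma real_matchLaw_Iic {b : ℝ} (hb : b ∈ Icc (0 : ℝ) 1) : matchLaw.real (Iic b) = b := by
  have : Iic b ∩ Icc (0 : ℝ) 1 = Icc 0 b := by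
    ext v
    simp only [mem_inter_iff, mem_Iic, mem_Icc]
    exact ⟨fun h => ⟨h.2.1, h.1⟩, fun h => ⟨h.2, h.1, h.2.trans hb.2⟩⟩
  rw [matchLaw, measureReal_restrict_apply measurableSet_Iic, this]
  simp [hb.1]

lemma real_matchLaw_Iio {b : ℝ} (hb : b ∈ Icc (0 : ℝ) 1) : matchLaw.real (Iio b) = b := by
  have : Iio b ∩ Icc (0 : ℝ) 1 = Ico 0 b := by
    ext v
    simp only [mem_inter_iff, mem_Iio, mem_Icc, mem_Ico]
    exact ⟨fun h => ⟨h.2.1, h.1⟩, fun h => ⟨h.2, h.1, h.2.le.trans hb.2⟩⟩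
  rw [matchLaw, measureReal_restrict_apply measurableSet_Iio, this]
  simp [hb.1]

lemma real_matchLaw_Ici {b : ℝ} (hb : b ∈ Icc (0 : ℝ) 1) : matchLaw.real (Ici b) = 1 - b :=
  real_matchLaw_eq_of_Ioi_subset hb Ioi_subset_Ici_self subset_rfl

/-- Consumers with match values `u ≤ y` at the first seller and `v > x + y` at the second one go
on to the second seller and buy there. -/
lemma le_demandSecond {s A p x y : ℝ} (hs : 0 < s) (hA : searchValue A = s) (hp : 0 ≤ p)
    (hx : 0 ≤ x) (hy : 0 ≤ y) (hxy : x + y ≤ A) (hA1 : A ≤ 1) :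
    y * (1 - x - y) ≤ demandSecond s p x := by
  have h₁ : matchLaw.real (Iic y) = y := real_matchLaw_Iic ⟨hy, by linarith⟩
  have h₂ : matchLaw.real (Ioi (x + y)) = 1 - (x + y) :=
    real_matchLaw_eq_of_Ioi_subset ⟨by linarith, by linarith⟩ subset_rfl Ioi_subset_Ici_self
  calc y * (1 - x - y) = (matchLaw.prod matchLaw).real (Iic y ×ˢ Ioi (x + y)) := by
        rw [measureReal_prod_prod, h₁, h₂]; ring
    _ ≤ _ := by
      refine measureReal_mono fun z hz => ?_
      obtain ⟨hz₁, hz₂⟩ := hz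
      rw [mem_Iic] at hz₁
      rw [mem_Ioi] at hz₂
      rw [mem_ofPred_eq, buysSecond_iff hs hA]
      refine ⟨?_, by linarith, by linarith⟩
      have : max 0 (z.1 - p) ≤ y := max_le hy (by linarith)
      linarith

lemma demandFirst_le (s q : ℝ) {p : ℝ} (hp : p ∈ Icc (0 : ℝ) 1) : demandFirst s p q ≤ 1 - p := by
  calc demandFirst s p q ≤ (matchLaw.prod matchLaw).real (Ici p ×ˢ univ) :=
        measureReal_mono fun x hx => ⟨sub_nonneg.mp hx.1, mem_univ _⟩
    _ = 1 - p := by rw [measureReal_prod_prod, real_matchLaw_Ici hp]; simp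

lemma demandSecond_le (s p : ℝ) {q : ℝ} (hq : q ∈ Icc (0 : ℝ) 1) :
    demandSecond s p q ≤ 1 - q := by
  calc demandSecond s p q ≤ (matchLaw.prod matchLaw).real (univ ×ˢ Ici q) :=
        measureReal_mono fun x hx => ⟨mem_univ _, sub_nonneg.mp hx.2.1⟩
    _ = 1 - q := by rw [measureReal_prod_prod, real_matchLaw_Ici hq]; simp

lemma demandFirst_of_one_le (s q : ℝ) {p : ℝ} (hp : 1 ≤ p) : demandFirst s p q = 0 := by
  refine le_antisymm ?_ (demandFirst_nonneg s p q)
  calc demandFirst s p q ≤ (matchLaw.prod matchLaw).real (Ici 1 ×ˢ univ) :=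
        measureReal_mono fun x hx => ⟨hp.trans (sub_nonneg.mp hx.1), mem_univ _⟩
    _ = 0 := by rw [measureReal_prod_prod, real_matchLaw_Ici ⟨zero_le_one, le_rfl⟩]; simp

lemma demandFirst_of_lt {s A p q : ℝ} (hs : 0 < s) (hA : searchValue A = s)
    (hp : p ∈ Icc (0 : ℝ) 1) (hq : A < q) : demandFirst s p q = 1 - p := by
  have : {x | BuysFirst s p q x} = Ici p ×ˢ univ := by
    ext x
    rw [mem_ofPred_eq, buysFirst_iff hs hA]
    have := le_max_left 0 (x.1 - p)
    simp only [mem_prod, mem_Ici, mem_univ, and_true, sub_nonneg, and_iff_left_iff_imp]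
    exact fun _ => Or.inl (by linarith)
  rw [demandFirst, this, measureReal_prod_prod, real_matchLaw_Ici hp]
  simp

/-- If the seller ranked second charges at most the reservation value, only the consumers with
match values below both prices do not buy. -/
lemma demandFirst_add_demandSecond {s A p q : ℝ} (hs : 0 < s) (hA : searchValue A = s)
    (hp : p ∈ Icc (0 : ℝ) 1) (hq : q ∈ Icc (0 : ℝ) 1) (hqA : q ≤ A) :
    demandFirst s p q + demandSecond s p q = 1 - p * q := by
  have hd : Disjoint {x | BuysFirst s p q x} {x | BuysSecond s p q x} := by
    refine Set.disjoint_left.mpr fun x h₁ h₂ => ?_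
    rcases h₁.2 with h | h
    · exact h h₂.1
    · exact not_lt.mpr h h₂.2.2
  have hu : {x | BuysFirst s p q x} ∪ {x | BuysSecond s p q x} = (Iio p ×ˢ Iio q)ᶜ := by
    ext x
    simp only [mem_union, mem_ofPred_eq, buysFirst_iff hs hA, buysSecond_iff hs hA, mem_compl_iff,
      mem_prod, mem_Iio, not_and, not_lt]
    constructor
    · rintro (h | h) h'
      · linarith [h.1]
      · linarith [h.2.1]
    · intro h
      rcases lt_or_ge x.1 p with h₁ | h₁
      · have := h h₁
        refine Or.inr ⟨?_, by linarith, by linarith⟩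
        rw [max_eq_left (by linarith)]
        linarith
      · by_cases h₂ : A < q + max 0 (x.1 - p)
        · exact Or.inl ⟨by linarith, Or.inl h₂⟩
        · rcases le_or_gt (x.2 - q) (x.1 - p) with h₃ | h₃
          · exact Or.inl ⟨by linarith, Or.inr h₃⟩
          · exact Or.inr ⟨not_lt.mp h₂, by linarith, h₃⟩
  rw [demandFirst, demandSecond, ← measureReal_union hd (measurableSet_buysSecond hs hA p q), hu,
    probReal_compl_eq_one_sub (measurableSet_Iio.prod measurableSet_Iio), measureReal_prod_prod,
    real_matchLaw_Iio hp, real_matchLaw_Iio hq]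

/-! ### Best deviations of the seller ranked second -/

/-- `A` is the reservation value for the search cost `s`, and it is positive: a consumer who got
nothing from the first seller inspects a second seller with a price slightly above zero. -/
structure IsReservationValue (s A : ℝ) : Prop where
  cost_pos : 0 < s
  value_eq : searchValue A = s
  pos : 0 < A

lemma IsReservationValue.lt_one {s A : ℝ} (h : IsReservationValue s A) : A < 1 := by
  by_contra! h'
  have := searchValue_of_one_le h'
  linarith [h.cost_pos, h.value_eq]

lemma secondDemand_le {A p x : ℝ} (hA1 : A ≤ 1) :
    secondDemand A p x ≤ p * (1 - x) + ((1 - x) ^ 2 - (1 - A) ^ 2) / 2 := by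
  rw [secondDemand]
  have hT : min (1 - p) (A - x) ≤ A - x := min_le_right _ _
  nlinarith [mul_nonneg (sub_nonneg.mpr hT) (sub_nonneg.mpr hA1),
    sq_nonneg (A - x - min (1 - p) (A - x))]

/-- If the second price is not too far below the first one, some consumers with the best match
value at the first seller do not go on. -/
lemma secondDemand_of_sub_le {A p x : ℝ} (hx : p - (1 - A) ≤ x) :
    secondDemand A p x = p * (1 - x) + ((1 - x) ^ 2 - (1 - A) ^ 2) / 2 := by
  rw [secondDemand, min_eq_right (by linarith)]
  ring

/-- If the second price is far below the first one, every consumer goes on. -/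
lemma secondDemand_of_le_sub {A p x : ℝ} (hx : x ≤ p - (1 - A)) :
    secondDemand A p x = (1 + 2 * p - p ^ 2) / 2 - x := by
  rw [secondDemand, min_eq_left (by linarith)]
  ring

lemma continuous_secondDemand (A : ℝ) : Continuous fun z : ℝ × ℝ => secondDemand A z.1 z.2 := by
  unfold secondDemand
  fun_prop

/-- The demand of the second seller is star-shaped in the price of the first one. -/
lemma mul_secondDemand_le {A p p' x : ℝ} (hA1 : A ≤ 1) (hp' : 0 ≤ p') (hpp : p' ≤ p) (hp : p ≤ 1)
    (hxA : x ≤ A) : p' * secondDemand A p x ≤ p * secondDemand A p' x := by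
  rw [secondDemand, secondDemand]
  set T := min (1 - p) (A - x)
  set T' := min (1 - p') (A - x)
  have hT : 0 ≤ T := le_min (by linarith) (by linarith)
  have hTT : T ≤ T' := min_le_min_right _ (by linarith)
  have hT' : T' ≤ 1 - x := (min_le_right _ _).trans (by linarith)
  have h₁ : 0 ≤ (T' - T) * ((1 - x) - (T' + T) / 2) :=
    mul_nonneg (by linarith) (by linarith)
  have h₂ : 0 ≤ T * ((1 - x) - T / 2) := mul_nonneg hT (by linarith)
  nlinarith [mul_nonneg (sub_nonneg.mpr hpp) h₂, mul_nonneg (hp'.trans hpp) h₁]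

/-- The difference between the demand of a seller ranked first and its demand ranked second; it is
the same for both sellers. -/
noncomputable def rankGain (A p q : ℝ) : ℝ := 1 - p * q - secondDemand A p q - secondDemand A q p

lemma rankGain_comm (A p q : ℝ) : rankGain A p q = rankGain A q p := by
  rw [rankGain, rankGain]; ring

lemma rankGain_pos {A p q : ℝ} (hA1 : A < 1) : 0 < rankGain A p q := by
  wlog hpq : q ≤ p generalizing p q
  · rw [rankGain_comm]; exact this (not_le.mp hpq).le
  rw [rankGain, secondDemand_of_sub_le (p := q) (x := p) (by linarith)]
  rcases le_total (p - (1 - A)) q with h | h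
  · rw [secondDemand_of_sub_le h]
    nlinarith
  · rw [secondDemand_of_le_sub h]
    nlinarith

/-- The largest profit a seller can get ranked second, when the first one charges `p`. The supremum
is attained for `p ∈ [0, 1]`, see `exists_best_deviation`. -/
noncomputable def deviationProfit (s p : ℝ) : ℝ := ⨆ x, x * demandSecond s p x

lemma exists_best_deviation {s A p : ℝ} (h : IsReservationValue s A) (hp : p ∈ Icc (0 : ℝ) 1) :
    ∃ x ∈ Icc 0 A, deviationProfit s p = x * secondDemand A p x ∧
      ∀ y, y * demandSecond s p y ≤ deviationProfit s p := by
  have hA1 := h.lt_one.le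
  have hc : Continuous fun x => x * secondDemand A p x :=
    continuous_id.mul ((continuous_secondDemand A).comp (Continuous.prodMk_right p))
  obtain ⟨x, hx, hmax⟩ := isCompact_Icc.exists_isMaxOn (nonempty_Icc.mpr h.pos.le) hc.continuousOn
  have hle : ∀ y, y * demandSecond s p y ≤ x * secondDemand A p x := by
    intro y
    have h0 : 0 ≤ x * secondDemand A p x := by
      simpa using hmax (left_mem_Icc.mpr h.pos.le)
    rcases lt_or_ge y 0 with hy | hy
    · exact (mul_nonpos_of_nonpos_of_nonneg hy.le (demandSecond_nonneg _ _ _)).trans h0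
    rcases lt_or_ge A y with hy' | hy'
    · rw [demandSecond_of_lt h.cost_pos h.value_eq hy']
      simpa using h0
    · rw [demandSecond_eq h.cost_pos h.value_eq hA1 hp ⟨hy, hy'⟩]
      exact hmax ⟨hy, hy'⟩
  have heq : deviationProfit s p = x * secondDemand A p x := by
    refine le_antisymm (ciSup_le hle) ?_
    rw [← demandSecond_eq h.cost_pos h.value_eq hA1 hp hx]
    exact le_ciSup (f := fun y => y * demandSecond s p y) ⟨_, forall_mem_range.mpr hle⟩ x
  exact ⟨x, hx, heq, fun y => heq ▸ hle y⟩

lemma mul_demandSecond_le_deviationProfit {s A p : ℝ} (h : IsReservationValue s A)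
    (hp : p ∈ Icc (0 : ℝ) 1) (y : ℝ) : y * demandSecond s p y ≤ deviationProfit s p :=
  let ⟨_, _, _, h'⟩ := exists_best_deviation h hp
  h' y

lemma mul_secondDemand_le_deviationProfit {s A p x : ℝ} (h : IsReservationValue s A)
    (hp : p ∈ Icc (0 : ℝ) 1) (hx : x ∈ Icc 0 A) :
    x * secondDemand A p x ≤ deviationProfit s p := by
  rw [← demandSecond_eq h.cost_pos h.value_eq h.lt_one.le hp hx]
  exact mul_demandSecond_le_deviationProfit h hp x

lemma deviationProfit_le_iff {s A p t : ℝ} (h : IsReservationValue s A) (hp : p ∈ Icc (0 : ℝ) 1) :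
    deviationProfit s p ≤ t ↔ ∀ x, x * demandSecond s p x ≤ t := by
  refine ⟨fun ht x => (mul_demandSecond_le_deviationProfit h hp x).trans ht, fun ht => ciSup_le ht⟩

lemma deviationProfit_mono {s A p p' : ℝ} (h : IsReservationValue s A) (hp : 0 ≤ p)
    (hpp : p ≤ p') (hp' : p' ≤ 1) : deviationProfit s p ≤ deviationProfit s p' := by
  obtain ⟨x, hx, he, -⟩ := exists_best_deviation h ⟨hp, hpp.trans hp'⟩
  rw [he, ← demandSecond_eq h.cost_pos h.value_eq h.lt_one.le ⟨hp, hpp.trans hp'⟩ hx]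
  exact (mul_le_mul_of_nonneg_left (demandSecond_mono h.cost_pos h.value_eq hpp x) hx.1).trans
    (mul_demandSecond_le_deviationProfit h ⟨hp.trans hpp, hp'⟩ x)

lemma mul_deviationProfit_le {s A p p' : ℝ} (h : IsReservationValue s A) (hp' : 0 ≤ p')
    (hpp : p' ≤ p) (hp : p ≤ 1) : p' * deviationProfit s p ≤ p * deviationProfit s p' := by
  obtain ⟨x, hx, he, -⟩ := exists_best_deviation h ⟨hp'.trans hpp, hp⟩
  have h₁ := mul_secondDemand_le_deviationProfit h ⟨hp', hpp.trans hp⟩ hx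
  have h₂ := mul_secondDemand_le h.lt_one.le hp' hpp hp hx.2
  rw [he]
  calc p' * (x * secondDemand A p x) = x * (p' * secondDemand A p x) := by ring
    _ ≤ x * (p * secondDemand A p' x) := mul_le_mul_of_nonneg_left h₂ hx.1
    _ = p * (x * secondDemand A p' x) := by ring
    _ ≤ _ := mul_le_mul_of_nonneg_left h₁ (hp'.trans hpp)

lemma deviationProfit_pos {s A p : ℝ} (h : IsReservationValue s A) (hp : p ∈ Icc (0 : ℝ) 1) :
    0 < deviationProfit s p := by
  have hA := h.pos
  have hA1 := h.lt_one
  have h₁ := le_demandSecond (x := A / 2) (y := A / 2) h.cost_pos h.value_eq hp.1 (by linarith)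
    (by linarith) (by linarith) hA1.le
  have h₂ := mul_demandSecond_le_deviationProfit h hp (A / 2)
  have h₃ : 0 < A / 2 * (A / 2 * (1 - A / 2 - A / 2)) :=
    mul_pos (by linarith) (mul_pos (by linarith) (by linarith))
  have h₄ := mul_le_mul_of_nonneg_left h₁ (by linarith : 0 ≤ A / 2)
  linarith

/-! ### Implementable contracts -/

lemma profit₁_eq {s A p q : ℝ} (h : IsReservationValue s A) (hp : p ∈ Icc 0 A) (hq : q ∈ Icc 0 A)
    (α : ℝ) : profit₁ s ⟨p, q, α⟩ = p * (secondDemand A q p + α * rankGain A p q) := by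
  have hA1 := h.lt_one.le
  have hp' : p ∈ Icc (0 : ℝ) 1 := ⟨hp.1, hp.2.trans hA1⟩
  have hq' : q ∈ Icc (0 : ℝ) 1 := ⟨hq.1, hq.2.trans hA1⟩
  have h₁ := demandFirst_add_demandSecond h.cost_pos h.value_eq hp' hq' hq.2
  rw [demandSecond_eq h.cost_pos h.value_eq hA1 hp' hq] at h₁
  rw [profit₁, demandSecond_eq h.cost_pos h.value_eq hA1 hq' hp, eq_sub_of_add_eq h₁, rankGain]
  ring

lemma profit₂_eq {s A p q : ℝ} (h : IsReservationValue s A) (hp : p ∈ Icc 0 A) (hq : q ∈ Icc 0 A)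
    (α : ℝ) : profit₂ s ⟨p, q, α⟩ = q * (secondDemand A p q + (1 - α) * rankGain A p q) := by
  have hA1 := h.lt_one.le
  have hp' : p ∈ Icc (0 : ℝ) 1 := ⟨hp.1, hp.2.trans hA1⟩
  have hq' : q ∈ Icc (0 : ℝ) 1 := ⟨hq.1, hq.2.trans hA1⟩
  have h₁ := demandFirst_add_demandSecond h.cost_pos h.value_eq hq' hp' hp.2
  rw [demandSecond_eq h.cost_pos h.value_eq hA1 hq' hp] at h₁
  rw [profit₂, demandSecond_eq h.cost_pos h.value_eq hA1 hp' hq, eq_sub_of_add_eq h₁, rankGain]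
  ring

lemma implementable_iff {s A p q : ℝ} (h : IsReservationValue s A) (hp : p ∈ Icc (0 : ℝ) 1)
    (hq : q ∈ Icc (0 : ℝ) 1) (α : ℝ) :
    Implementable s ⟨p, q, α⟩ ↔ α ∈ Icc (0 : ℝ) 1 ∧
      deviationProfit s q ≤ profit₁ s ⟨p, q, α⟩ ∧ deviationProfit s p ≤ profit₂ s ⟨p, q, α⟩ := by
  rw [deviationProfit_le_iff h hq, deviationProfit_le_iff h hp, Implementable]

/-- The contract with the two sellers exchanged. -/
def Contract.swap (c : Contract) : Contract := ⟨c.price₂, c.price₁, 1 - c.prob⟩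

lemma profit₁_swap (s : ℝ) (c : Contract) : profit₁ s c.swap = profit₂ s c := by
  simp only [profit₁, profit₂, Contract.swap]; ring

lemma profit₂_swap (s : ℝ) (c : Contract) : profit₂ s c.swap = profit₁ s c := by
  simp only [profit₁, profit₂, Contract.swap]; ring

lemma industryProfit_swap (s : ℝ) (c : Contract) :
    industryProfit s c.swap = industryProfit s c := by
  rw [industryProfit, industryProfit, profit₁_swap, profit₂_swap, add_comm]

lemma Implementable.swap {s : ℝ} {c : Contract} (hc : Implementable s c) :
    Implementable s c.swap := by
  refine ⟨⟨?_, ?_⟩, ?_, ?_⟩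
  · have := hc.1.2; simp only [Contract.swap]; linarith
  · have := hc.1.1; simp only [Contract.swap]; linarith
  · rw [profit₁_swap]; exact hc.2.2
  · rw [profit₂_swap]; exact hc.2.1

/-- If the two best deviation profits leave room for each other, some probability of being ranked
first satisfies both incentive constraints, and makes that of seller 1 bind. -/
lemma exists_implementable_of_le {s A p q : ℝ} (h : IsReservationValue s A) (hp : p ∈ Ioc 0 A)
    (hq : q ∈ Ioc 0 A) (hle : p * deviationProfit s p + q * deviationProfit s q ≤
      p * q * (1 - p * q)) :
    ∃ α, Implementable s ⟨p, q, α⟩ ∧ profit₁ s ⟨p, q, α⟩ = deviationProfit s q := by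
  obtain ⟨hp0, hpA⟩ := hp
  obtain ⟨hq0, hqA⟩ := hq
  have hA1 := h.lt_one.le
  have hp' : p ∈ Icc (0 : ℝ) 1 := ⟨hp0.le, hpA.trans hA1⟩
  have hq' : q ∈ Icc (0 : ℝ) 1 := ⟨hq0.le, hqA.trans hA1⟩
  have hΔ : 0 < rankGain A p q := rankGain_pos h.lt_one
  have hsum : secondDemand A p q + secondDemand A q p + rankGain A p q = 1 - p * q := by
    rw [rankGain]; ring
  have h₁ := mul_secondDemand_le_deviationProfit h hq' ⟨hp0.le, hpA⟩
  have h₂ := mul_secondDemand_le_deviationProfit h hp' ⟨hq0.le, hqA⟩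
  set α := (deviationProfit s q / p - secondDemand A q p) / rankGain A p q with hα
  have hαΔ : p * (secondDemand A q p + α * rankGain A p q) = deviationProfit s q := by
    rw [hα]; field_simp; ring
  have hα₂ : deviationProfit s p ≤ q * (secondDemand A p q + (1 - α) * rankGain A p q) := by
    refine le_of_mul_le_mul_left ?_ hp0
    rw [← hsum, ← hαΔ] at hle
    linarith
  have hα0 : 0 ≤ α := by
    refine div_nonneg ?_ hΔ.le
    rw [sub_nonneg, le_div_iff₀ hp0]
    linarith
  have hα1 : α ≤ 1 := by
    have : 0 ≤ (q * rankGain A p q) * (1 - α) := by linarith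
    linarith [nonneg_of_mul_nonneg_right this (mul_pos hq0 hΔ)]
  refine ⟨α, ?_, ?_⟩
  · rw [implementable_iff h hp' hq', profit₁_eq h ⟨hp0.le, hpA⟩ ⟨hq0.le, hqA⟩,
      profit₂_eq h ⟨hp0.le, hpA⟩ ⟨hq0.le, hqA⟩]
    exact ⟨⟨hα0, hα1⟩, hαΔ.ge, hα₂⟩
  · rw [profit₁_eq h ⟨hp0.le, hpA⟩ ⟨hq0.le, hqA⟩, hαΔ]

lemma exists_implementable_iff {s A p q : ℝ} (h : IsReservationValue s A) (hp : p ∈ Ioc 0 A)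
    (hq : q ∈ Ioc 0 A) : (p, q) ∈ implementablePrices s ↔
      p * deviationProfit s p + q * deviationProfit s q ≤ p * q * (1 - p * q) := by
  constructor
  · rintro ⟨α, hα⟩
    have hA1 := h.lt_one.le
    rw [implementable_iff h ⟨hp.1.le, hp.2.trans hA1⟩ ⟨hq.1.le, hq.2.trans hA1⟩,
      profit₁_eq h (Ioc_subset_Icc_self hp) (Ioc_subset_Icc_self hq),
      profit₂_eq h (Ioc_subset_Icc_self hp) (Ioc_subset_Icc_self hq)] at hα
    have hsum : 1 - p * q = secondDemand A p q + secondDemand A q p + rankGain A p q := by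
      rw [rankGain]; ring
    rw [hsum]
    linarith [mul_le_mul_of_nonneg_left hα.2.1 hq.1.le,
      mul_le_mul_of_nonneg_left hα.2.2 hp.1.le]
  · intro hle
    obtain ⟨α, hα, -⟩ := exists_implementable_of_le h hp hq hle
    exact ⟨α, hα⟩

lemma industryProfit_eq {s A p q : ℝ} (h : IsReservationValue s A) (hp : p ∈ Icc 0 A)
    (hq : q ∈ Icc 0 A) (α : ℝ) : industryProfit s ⟨p, q, α⟩ =
      q * (1 - p * q) - (q - p) * (secondDemand A q p + α * rankGain A p q) := by
  rw [industryProfit, profit₁_eq h hp hq, profit₂_eq h hp hq, rankGain]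
  ring

/-! ### Prices of implementable contracts -/

lemma Implementable.profit₁_nonneg {s : ℝ} {c : Contract} (hc : Implementable s c) :
    0 ≤ profit₁ s c := by simpa using hc.2.1 0

lemma Implementable.profit₁_pos {s A : ℝ} (h : IsReservationValue s A) {c : Contract}
    (hc : Implementable s c) (h₂ : 0 ≤ c.price₂) : 0 < profit₁ s c := by
  have hA := h.pos
  have hA1 := h.lt_one
  have h₁ := le_demandSecond (x := A / 2) (y := A / 2) h.cost_pos h.value_eq h₂ (by linarith)
    (by linarith) (by linarith) hA1.le
  have h₃ : 0 < A / 2 * (A / 2 * (1 - A / 2 - A / 2)) :=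
    mul_pos (by linarith) (mul_pos (by linarith) (by linarith))
  have h₄ := mul_le_mul_of_nonneg_left h₁ (by linarith : 0 ≤ A / 2)
  linarith [hc.2.1 (A / 2)]

/-- The cheaper seller cannot have a negative price: it would have a positive demand in either
position, hence a loss. -/
lemma Implementable.price₁_nonneg_of_le {s A : ℝ} (h : IsReservationValue s A) {c : Contract}
    (hc : Implementable s c) (hle : c.price₁ ≤ c.price₂) : 0 ≤ c.price₁ := by
  by_contra! hneg
  have hA := h.pos
  have hA1 := h.lt_one
  have hhalf : (1 / 2 : ℝ) ∈ Icc (0 : ℝ) 1 := by norm_num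
  have h₁ : 0 < demandFirst s c.price₁ c.price₂ := by
    calc (0 : ℝ) < (matchLaw.prod matchLaw).real (Ici (1 / 2) ×ˢ Iic (1 / 2)) := by
          rw [measureReal_prod_prod, real_matchLaw_Ici hhalf, real_matchLaw_Iic hhalf]; norm_num
      _ ≤ _ := by
        refine measureReal_mono fun x hx => ?_
        have hx₁ : 1 / 2 ≤ x.1 := hx.1
        have hx₂ : x.2 ≤ 1 / 2 := hx.2
        exact ⟨by linarith, Or.inr (by linarith)⟩
  have h₂ : 0 < demandSecond s c.price₂ c.price₁ := by
    calc (0 : ℝ) < (matchLaw.prod matchLaw).real (Iic A ×ˢ Ioi A) := by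
          rw [measureReal_prod_prod, real_matchLaw_Iic ⟨hA.le, hA1.le⟩,
            real_matchLaw_eq_of_Ioi_subset ⟨hA.le, hA1.le⟩ subset_rfl Ioi_subset_Ici_self]
          exact mul_pos hA (by linarith)
      _ ≤ _ := by
        refine measureReal_mono fun x hx => ?_
        have hx₁ : x.1 ≤ A := hx.1
        have hx₂ : A < x.2 := hx.2
        rw [mem_ofPred_eq, buysSecond_iff h.cost_pos h.value_eq]
        refine ⟨?_, by linarith, by linarith⟩
        have : max 0 (x.1 - c.price₂) ≤ A - c.price₁ := max_le (by linarith) (by linarith)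
        linarith
  have hneg₁ := mul_neg_of_neg_of_pos hneg h₁
  have hneg₂ := mul_neg_of_neg_of_pos hneg h₂
  have := hc.profit₁_nonneg
  rw [profit₁] at this
  obtain ⟨hα0, hα1⟩ := hc.1
  rcases hα0.eq_or_lt with hα | hα
  · rw [← hα] at this; linarith
  · nlinarith [mul_neg_of_pos_of_neg hα hneg₁]

lemma Implementable.prices_nonneg {s A : ℝ} (h : IsReservationValue s A) {c : Contract}
    (hc : Implementable s c) : 0 ≤ c.price₁ ∧ 0 ≤ c.price₂ := by
  rcases le_total c.price₁ c.price₂ with hle | hle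
  · have := hc.price₁_nonneg_of_le h hle
    exact ⟨this, this.trans hle⟩
  · have : 0 ≤ c.price₂ := hc.swap.price₁_nonneg_of_le h hle
    exact ⟨this.trans hle, this⟩

lemma Implementable.price₁_mem {s A : ℝ} (h : IsReservationValue s A) {c : Contract}
    (hc : Implementable s c) : c.price₁ ∈ Ioo (0 : ℝ) 1 := by
  obtain ⟨h₁, h₂⟩ := hc.prices_nonneg h
  have hpos := hc.profit₁_pos h h₂
  refine ⟨h₁.lt_of_ne fun h0 => ?_, ?_⟩
  · rw [profit₁, ← h0] at hpos
    linarith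
  · by_contra! h'
    rw [profit₁, demandFirst_of_one_le s _ h',
      demandSecond_of_lt h.cost_pos h.value_eq (h.lt_one.trans_le h')] at hpos
    linarith

lemma Implementable.price₂_mem {s A : ℝ} (h : IsReservationValue s A) {c : Contract}
    (hc : Implementable s c) : c.price₂ ∈ Ioo (0 : ℝ) 1 := hc.swap.price₁_mem h

/-! ### The nondegenerate case -/

lemma isReservationValue_of_cost {s A : ℝ} (hA : A ∈ Ioo (0 : ℝ) 1) (hs : s = (1 - A) ^ 2 / 2) :
    IsReservationValue s A := by
  refine ⟨?_, ?_, hA.1⟩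
  · rw [hs]; have : 0 < 1 - A := by linarith [hA.2]
    positivity
  · rw [searchValue_of_mem_Icc ⟨hA.1.le, hA.2.le⟩, hs]

/-- A seller with a price above `A` sells only when ranked first, to fewer than `1 - A` consumers;
for small search costs this is worth less than a deviation to the price `1 / 2`. -/
lemma Implementable.price₁_le {s A : ℝ} (h : IsReservationValue s A) (hA : 31 / 32 ≤ A)
    {c : Contract} (hc : Implementable s c) : c.price₁ ≤ A := by
  by_contra! hlt
  have h₁ := hc.price₁_mem h
  have h₂ := hc.price₂_mem h
  have hd := le_demandSecond (x := 1 / 2) (y := 1 / 4) h.cost_pos h.value_eq h₂.1.le (by norm_num)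
    (by norm_num) (by linarith) h.lt_one.le
  have hdev := hc.2.1 (1 / 2)
  rw [profit₁, demandSecond_of_lt h.cost_pos h.value_eq hlt] at hdev
  have hD := demandFirst_le s c.price₂ ⟨h₁.1.le, h₁.2.le⟩
  have hb : c.prob * (c.price₁ * demandFirst s c.price₁ c.price₂) ≤
      1 * (1 * (1 - c.price₁)) := by
    have := demandFirst_nonneg s c.price₁ c.price₂
    have h₁0 := h₁.1.le
    have h₁1 := h₁.2.le
    have hα := hc.1.2
    have hα0 := hc.1.1
    gcongr
  linarith

lemma nondegenerate_of_lt {s : ℝ} (hs : 0 < s) (hs' : s < 1 / 2048) : Nondegenerate s := by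
  have hsq : √(2 * s) ^ 2 = 2 * s := Real.sq_sqrt (by linarith)
  have hpos : 0 < √(2 * s) := Real.sqrt_pos.mpr (by linarith)
  have hlt : √(2 * s) < 1 / 32 := by
    rw [Real.sqrt_lt' (by norm_num)]; linarith
  have h : IsReservationValue s (1 - √(2 * s)) :=
    isReservationValue_of_cost ⟨by linarith, by linarith⟩ (by rw [sub_sub_cancel, hsq]; ring)
  refine ⟨_, h.value_eq, fun p ⟨α, hα⟩ => ⟨hα.price₁_le h (by linarith), ?_⟩⟩
  exact hα.swap.price₁_le h (by linarith)

/-- For search costs above that of the reservation value `2 / 5`, both sellers can charge `2 / 5`: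
consumers never visit the second seller, and undercutting does not pay. -/
lemma implementable_of_reservationValue_lt {s A : ℝ} (hs : 0 < s) (hA : searchValue A = s)
    (hlt : A < 2 / 5) : Implementable s ⟨2 / 5, 2 / 5, 1 / 2⟩ := by
  have hm : (2 / 5 : ℝ) ∈ Icc (0 : ℝ) 1 := by norm_num
  have hdev : ∀ x, x * demandSecond s (2 / 5) x ≤ 3 / 25 := by
    intro x
    rcases lt_or_ge x 0 with hx | hx
    · have := mul_nonpos_of_nonpos_of_nonneg hx.le (demandSecond_nonneg s (2 / 5) x)
      linarith
    rcases lt_or_ge A x with hxA | hxA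
    · rw [demandSecond_of_lt hs hA hxA]; norm_num
    · rw [demandSecond_eq hs hA (by linarith) hm ⟨hx, hxA⟩]
      refine (mul_le_mul_of_nonneg_left (secondDemand_le (by linarith)) hx).trans ?_
      nlinarith [sq_nonneg (x - 3 / 10), mul_nonneg hx (by linarith : 0 ≤ 2 / 5 - A),
        mul_nonneg (mul_nonneg hx hx) (by linarith : 0 ≤ 2 / 5 - x),
        mul_nonneg hx (sq_nonneg (A - 2 / 5))]
  refine ⟨by norm_num, fun x => (hdev x).trans_eq ?_, fun x => (hdev x).trans_eq ?_⟩
  · rw [profit₁, demandSecond_of_lt hs hA hlt, demandFirst_of_lt hs hA hm hlt]; norm_num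
  · rw [profit₂, demandSecond_of_lt hs hA hlt, demandFirst_of_lt hs hA hm hlt]; norm_num

/-- For moderate search costs, one seller can charge a price above the reservation value, provided
that it is ranked first sufficiently often and that the other seller is much cheaper. -/
lemma implementable_of_reservationValue_mem {s A : ℝ} (hs : 0 < s) (hA : searchValue A = s)
    (hA' : A ∈ Icc (2 / 5 : ℝ) (289 / 500)) : Implementable s ⟨29 / 50, 2 / 5, 4 / 5⟩ := by
  obtain ⟨hA0, hA1⟩ := hA'
  have hm : (2 / 5 : ℝ) ∈ Icc (0 : ℝ) 1 := by norm_num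
  have hm' : (29 / 50 : ℝ) ∈ Icc (0 : ℝ) 1 := by norm_num
  have hlt : A < 29 / 50 := by linarith
  -- All profits are affine in `S`, which ranges over `[0.178, 0.36]`.
  set S := (1 - A) ^ 2 with hS
  have hS0 : 178 / 1000 ≤ S := by rw [hS]; nlinarith
  have hS1 : S ≤ 9 / 25 := by rw [hS]; nlinarith
  have hdev : ∀ p ∈ Icc (0 : ℝ) 1, ∀ t, 0 ≤ t →
      (∀ x, 0 ≤ x → x ≤ 289 / 500 → x * (p * (1 - x) + ((1 - x) ^ 2 - S) / 2) ≤ t) →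
      ∀ x, x * demandSecond s p x ≤ t := by
    intro p hp t ht hle x
    rcases lt_or_ge x 0 with hx | hx
    · have := mul_nonpos_of_nonpos_of_nonneg hx.le (demandSecond_nonneg s p x)
      linarith
    rcases lt_or_ge A x with hxA | hxA
    · rw [demandSecond_of_lt hs hA hxA]; linarith
    · rw [demandSecond_eq hs hA (by linarith) hp ⟨hx, hxA⟩]
      exact (mul_le_mul_of_nonneg_left (secondDemand_le (by linarith)) hx).trans
        (hle x hx (hxA.trans hA1))
  have hd₂ : demandSecond s (29 / 50) (2 / 5) = 528 / 1000 - S / 2 := by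
    rw [demandSecond_eq hs hA (by linarith) hm' ⟨by norm_num, hA0⟩,
      secondDemand_of_sub_le (by linarith), ← hS]
    ring
  have hd₁ : demandFirst s (29 / 50) (2 / 5) = 24 / 100 + S / 2 := by
    have := demandFirst_add_demandSecond hs hA hm' hm hA0
    linarith
  refine ⟨by norm_num, ?_, ?_⟩
  · rw [profit₁, hd₁, demandSecond_of_lt hs hA hlt]
    refine hdev _ hm _ (by linarith) fun x hx0 hx1 => ?_
    nlinarith [mul_nonneg (sub_nonneg.mpr hS0) hx0, sq_nonneg (x - 37 / 100),
      mul_nonneg (mul_nonneg hx0 hx0) (sub_nonneg.mpr hx1)]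
  · rw [profit₂, hd₂, demandFirst_of_lt hs hA hm hlt]
    refine hdev _ hm' _ (by linarith) fun x hx0 hx1 => ?_
    rcases le_total x (32 / 100) with hx | hx
    · nlinarith [mul_nonneg (sub_nonneg.mpr hS1) (sub_nonneg.mpr hx), sq_nonneg (x - 32 / 100),
        mul_nonneg (mul_nonneg hx0 hx0) (sub_nonneg.mpr hx)]
    · nlinarith [mul_nonneg (sub_nonneg.mpr hS0) (sub_nonneg.mpr hx), sq_nonneg (x - 40 / 100),
        mul_nonneg (mul_nonneg hx0 hx0) (sub_nonneg.mpr hx1)]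

lemma Nondegenerate.exists_reservationValue {s : ℝ} (hs : 0 < s) (hn : Nondegenerate s) :
    ∃ A, IsReservationValue s A ∧ √3 / 3 < A ∧
      ∀ c, Implementable s c → c.price₁ ∈ Ioc 0 A ∧ c.price₂ ∈ Ioc 0 A := by
  obtain ⟨A, hA, hP⟩ := hn
  -- `289 / 500` lies between `√3 / 3` and the price `29 / 50` of the degenerate contract.
  have hA' : 289 / 500 < A := by
    by_contra! hle
    rcases lt_or_ge A (2 / 5) with hlt | hge
    · have := (hP (2 / 5, 2 / 5) ⟨_, implementable_of_reservationValue_lt hs hA hlt⟩).1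
      simp only at this
      linarith
    · have := (hP (29 / 50, 2 / 5) ⟨_, implementable_of_reservationValue_mem hs hA ⟨hge, hle⟩⟩).1
      simp only at this
      linarith
  have h : IsReservationValue s A := ⟨hs, hA, by linarith⟩
  refine ⟨A, h, ?_, fun c hc => ?_⟩
  · have : √3 < 1734 / 1000 := by
      rw [Real.sqrt_lt' (by norm_num)]; norm_num
    linarith
  · have := hP (c.price₁, c.price₂) ⟨c.prob, hc⟩
    exact ⟨⟨(hc.price₁_mem h).1, this.1⟩, ⟨(hc.price₂_mem h).1, this.2⟩⟩

/-! ### Harmonic means of implementable prices -/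

/-- The inequality behind `le_of_no_profitable_deviation` when the best deviation against `q` makes
every consumer go on, in the coordinates `d = q - p`, `e = p + q - 1`, `t = 2 q - 1`. -/
lemma far_deviation_ineq {d e t : ℝ} (hd : 0 ≤ d) (he : 0 < e) (ht : t = d + e) (ht1 : t ≤ 1) :
    256 * (d ^ 2 * (e * (2 + e))) < (1 + 6 * t + t ^ 2) ^ 2 * (1 + t - (1 + e - d) ^ 2 / 4) := by
  have ht0 : 0 < t := by linarith
  have h₁ : (8 * t) ^ 2 ≤ (1 + 6 * t + t ^ 2) ^ 2 := by
    refine pow_le_pow_left₀ (by linarith) ?_ 2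
    nlinarith [sq_nonneg (t - 1)]
  have h₂ : 2 * d + e + (1 - t) / 2 ≤ 1 + t - (1 + e - d) ^ 2 / 4 := by
    nlinarith [mul_nonneg hd he.le, mul_nonneg hd (sub_nonneg.mpr ht1),
      mul_nonneg he.le (sub_nonneg.mpr ht1)]
  have h₃ : 0 < (d + e) ^ 3 * (2 * d + e) - 4 * (d ^ 2 * e * (2 * d + 3 * e)) := by
    nlinarith [mul_nonneg hd he.le, pow_pos he 4, mul_nonneg hd (pow_pos he 3).le,
      sq_nonneg (d ^ 2 - d * e), sq_nonneg (d - e), sq_nonneg (d * (2 * d - 3 * e)),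
      mul_nonneg (mul_nonneg hd he.le) (sq_nonneg (d - e))]
  have h₄ : 4 * (d ^ 2 * (e * (2 + e))) < t ^ 2 * (2 * d + e) := by
    refine lt_of_mul_lt_mul_left ?_ ht0.le
    have : t * (4 * (d ^ 2 * (e * (2 + e)))) ≤ 4 * (d ^ 2 * e * (2 * d + 3 * e)) := by
      have : 0 ≤ d ^ 2 * e * (e * (1 - t)) := by
        have := sub_nonneg.mpr ht1
        positivity
      rw [ht] at this ⊢
      nlinarith
    rw [ht] at this ⊢
    nlinarith
  calc 256 * (d ^ 2 * (e * (2 + e))) < (8 * t) ^ 2 * (2 * d + e) := by linarith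
    _ ≤ (8 * t) ^ 2 * (1 + t - (1 + e - d) ^ 2 / 4) := by
      refine mul_le_mul_of_nonneg_left ?_ (by positivity)
      linarith
    _ ≤ _ := by
      refine mul_le_mul_of_nonneg_right h₁ ?_
      linarith

/-- The inequality behind `le_of_no_profitable_deviation` when the best deviation against `q` is the
highest price that makes every consumer go on, in the coordinates of `far_deviation_ineq`. -/
lemma near_deviation_ineq {d e t a : ℝ} (hd : 0 ≤ d) (he : 0 < e) (ht : t = d + e)
    (hta : (1 + 6 * t + t ^ 2) / 16 ≤ a) (hat : a ≤ (1 - t) / 2) :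
    d ^ 2 * (e * (2 + e)) < a ^ 2 * ((1 - t ^ 2) / 2 + a * (1 + t) - (1 + e - d) ^ 2 / 4) := by
  have ht0 : 0 < t := by linarith
  -- The two bounds on `a` give `t ^ 2 + 14 * t ≤ 7`; the constants below are nearly sharp there.
  have ht1 : t ≤ 29 / 60 := by nlinarith
  have ha : 855 / 1600 * t ≤ a := by nlinarith
  have h₁ : t * (10515 / 10000) + (d - e) / 2 - (d - e) ^ 2 / 4 ≤
      (1 - t ^ 2) / 2 + a * (1 + t) - (1 + e - d) ^ 2 / 4 := by
    nlinarith [mul_le_mul_of_nonneg_right ha (by linarith : 0 ≤ 1 + t)]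
  have h₂ : (2855 / 10000) * t ^ 2 ≤ a ^ 2 := by nlinarith
  have h₃ : d ^ 2 * (e * (2 * t + 29 / 60 * e)) < (2855 / 10000) * t ^ 2 *
      (t ^ 2 * (10515 / 10000) + t * (d - e) / 2 - 29 / 240 * (d - e) ^ 2) := by
    rw [ht]
    nlinarith [mul_nonneg hd he.le, pow_pos he 4, mul_nonneg hd (pow_pos he 3).le,
      sq_nonneg (d ^ 2 - d * e), sq_nonneg (d - e), sq_nonneg (d * (2 * d - 3 * e)),
      mul_nonneg (mul_nonneg hd he.le) (sq_nonneg (d - e)),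
      sq_nonneg (10 * d ^ 2 - 7 * d * e - 6 * e ^ 2)]
  have h₄ : d ^ 2 * (e * (2 + e)) < (2855 / 10000) * t ^ 2 *
      (t * (10515 / 10000) + (d - e) / 2 - (d - e) ^ 2 / 4) := by
    refine lt_of_mul_lt_mul_left ?_ ht0.le
    have e₁ : 0 ≤ d ^ 2 * (e * (e * (29 / 60 - t))) := by
      have := sub_nonneg.mpr ht1
      positivity
    have e₂ : 0 ≤ (2855 / 10000) * t ^ 2 * ((29 / 60 - t) * (d - e) ^ 2 / 4) := by
      have := sub_nonneg.mpr ht1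
      positivity
    linarith
  have h₅ : 0 < (1 - t ^ 2) / 2 + a * (1 + t) - (1 + e - d) ^ 2 / 4 := by
    refine lt_of_lt_of_le ?_ h₁
    have : 0 ≤ d ^ 2 * (e * (2 + e)) := by positivity
    exact pos_of_mul_pos_right (this.trans_lt h₄) (by positivity)
  calc _ < _ := h₄
    _ ≤ (2855 / 10000) * t ^ 2 * ((1 - t ^ 2) / 2 + a * (1 + t) - (1 + e - d) ^ 2 / 4) :=
      mul_le_mul_of_nonneg_left h₁ (by positivity)
    _ ≤ _ := mul_le_mul_of_nonneg_right h₂ h₅.le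

/-- Suppose that the sum of the incentive constraints survives the deviations to `p` against `p` and,
against `q`, to the price `q - a`, the highest one that makes every consumer go on, as well as to
the best price `(1 + 2 q - q²) / 4` among those that do, if it is below `q - a`. Then the right
derivative of the profit against `q` at the kink `q - a` is nonnegative. -/
lemma le_of_no_profitable_deviation {p q a : ℝ} (hp : 0 < p) (hpq : p ≤ q) (ha : 0 < a)
    (hqa : q ≤ 1 - a)
    (h₁ : p * (p * ((1 - p ^ 2 - a ^ 2) / 2)) +
      q * ((q - a) * ((1 + 2 * q - q ^ 2) / 2 - (q - a))) ≤ p * q * (1 - p * q))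
    (h₂ : (1 + 2 * q - q ^ 2) / 4 ≤ q - a → p * (p * ((1 - p ^ 2 - a ^ 2) / 2)) +
      q * ((1 + 2 * q - q ^ 2) / 4) ^ 2 ≤ p * q * (1 - p * q)) :
    (q - a) * (2 + a) ≤ (1 + 2 * q - q ^ 2) / 2 := by
  by_contra! hK
  have hq : 0 < q := hp.trans_le hpq
  have haqK : 0 < a * q * ((q - a) * (2 + a) - (1 + 2 * q - q ^ 2) / 2) := by
    have := sub_pos.mpr hK
    positivity
  -- The constraint `h₁`, expanded around the kink.
  have hid : (q - p) ^ 2 * (1 - (p + q) ^ 2) +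
      2 * (a * q * ((q - a) * (2 + a) - (1 + 2 * q - q ^ 2) / 2)) +
      a ^ 2 * (2 * q - 2 * q ^ 2 + 2 * a * q - p ^ 2) ≤ 0 := by
    linarith
  rcases le_or_gt (p + q) 1 with hσ | hσ
  · have e₁ : 0 ≤ (q - p) ^ 2 * (1 - (p + q) ^ 2) :=
      mul_nonneg (sq_nonneg _) (by nlinarith)
    have e₂ : 0 ≤ a ^ 2 * (2 * q - 2 * q ^ 2 + 2 * a * q - p ^ 2) := by
      refine mul_nonneg (sq_nonneg _) ?_
      nlinarith [mul_nonneg ha.le hq.le, mul_nonneg hq.le (sub_nonneg.mpr hσ),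
        mul_nonneg hp.le (sub_nonneg.mpr hpq)]
    linarith
  · have hd : 0 ≤ q - p := by linarith
    have he : 0 < p + q - 1 := by linarith
    have ht : 2 * q - 1 = (q - p) + (p + q - 1) := by ring
    rcases le_total ((1 + 2 * q - q ^ 2) / 4) (q - a) with hc | hc
    · have := far_deviation_ineq hd he ht (by linarith)
      have h₃ := h₂ hc
      have e₁ : a ^ 2 ≤ ((q ^ 2 + 2 * q - 1) / 4) ^ 2 :=
        pow_le_pow_left₀ ha.le (by linarith) 2
      have e₂ := mul_le_mul_of_nonneg_right e₁ (sq_nonneg p)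
      linarith
    · have := near_deviation_ineq (a := a) hd he ht (by linarith) (by linarith)
      linarith

/-- As long as the best deviation against the price `q` is not to let everybody go on, it can be
computed with the demand function that is affine in `q`. -/
lemma mul_affine_le_deviationProfit {s A q x : ℝ} (h : IsReservationValue s A)
    (hq : q ∈ Icc (0 : ℝ) 1) (hx : x ∈ Icc 0 A)
    (hK : (q - (1 - A)) * (2 + (1 - A)) ≤ (1 + 2 * q - q ^ 2) / 2) :
    x * (q * (1 - x) + ((1 - x) ^ 2 - (1 - A) ^ 2) / 2) ≤ deviationProfit s q := by
  have hA1 := h.lt_one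
  obtain ⟨hx0, hxA⟩ := hx
  obtain ⟨hq0, hq1⟩ := hq
  rcases le_total (q - (1 - A)) x with hqx | hqx
  · rw [← secondDemand_of_sub_le hqx]
    exact mul_secondDemand_le_deviationProfit h ⟨hq0, hq1⟩ ⟨hx0, hxA⟩
  · have hz := mul_secondDemand_le_deviationProfit h ⟨hq0, hq1⟩
      (x := q - (1 - A)) ⟨by linarith, by linarith⟩
    rw [secondDemand_of_le_sub le_rfl] at hz
    refine le_trans ?_ hz
    set z := q - (1 - A) with hzdef
    have e₁ : 0 ≤ (z - x) * ((1 + 2 * q - q ^ 2) / 2 - z * (3 - A)) :=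
      mul_nonneg (by linarith) (by linarith)
    have e₂ : 0 ≤ (z - x) ^ 2 * (q + 1 - z - x / 2) :=
      mul_nonneg (sq_nonneg _) (by linarith)
    have hA : A = z - q + 1 := by rw [hzdef]; ring
    rw [hA] at e₁ ⊢
    linarith

lemma diag_mem_iff {s A p : ℝ} (h : IsReservationValue s A) (hp : p ∈ Ioc 0 A) :
    (p, p) ∈ implementablePrices s ↔ 2 * deviationProfit s p ≤ p * (1 - p ^ 2) := by
  rw [exists_implementable_iff h hp hp]
  have hp0 := hp.1
  constructor
  · intro hle
    refine le_of_mul_le_mul_left ?_ hp0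
    linarith
  · intro hle
    linarith [mul_le_mul_of_nonneg_left hle hp0.le]

/-- In an implementable pair, both prices are so low that letting every consumer go on is not a best
deviation. -/
lemma le_of_mem_implementablePrices {s A p q : ℝ} (h : IsReservationValue s A) (hp : p ∈ Ioc 0 A)
    (hq : q ∈ Ioc 0 A) (hpq : p ≤ q) (hP : (p, q) ∈ implementablePrices s) :
    (q - (1 - A)) * (2 + (1 - A)) ≤ (1 + 2 * q - q ^ 2) / 2 := by
  have hA1 := h.lt_one
  rw [exists_implementable_iff h hp hq] at hP
  obtain ⟨hp0, hpA⟩ := hp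
  obtain ⟨hq0, hqA⟩ := hq
  have hp' : p ∈ Icc (0 : ℝ) 1 := ⟨hp0.le, by linarith⟩
  have hq' : q ∈ Icc (0 : ℝ) 1 := ⟨hq0.le, by linarith⟩
  have dp := mul_secondDemand_le_deviationProfit h hp' (x := p) ⟨hp0.le, hpA⟩
  rw [secondDemand_of_sub_le (by linarith)] at dp
  have dp' := mul_le_mul_of_nonneg_left dp hp0.le
  have hc : 0 ≤ (1 + 2 * q - q ^ 2) / 4 := by nlinarith
  rcases le_or_gt (q - (1 - A)) 0 with hneg | hpos
  · nlinarith [mul_nonneg (neg_nonneg.mpr hneg) (by linarith : 0 ≤ 2 + (1 - A))]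
  refine le_of_no_profitable_deviation hp0 hpq (by linarith) (by linarith) ?_ fun hle => ?_
  · have dq := mul_secondDemand_le_deviationProfit h hq' (x := q - (1 - A))
      ⟨hpos.le, by linarith⟩
    rw [secondDemand_of_le_sub le_rfl] at dq
    linarith [mul_le_mul_of_nonneg_left dq hq0.le]
  · have dq := mul_secondDemand_le_deviationProfit h hq' (x := (1 + 2 * q - q ^ 2) / 4)
      ⟨hc, by linarith⟩
    rw [secondDemand_of_le_sub hle] at dq
    linarith [mul_le_mul_of_nonneg_left dq hq0.le]

/-- The harmonic mean `m` of an implementable pair of prices is an implementable symmetric price: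
the best deviation against `m` is also available against `p` and `q`, and its profit is affine in
the price of the first seller. -/
lemma harmonicMean_mem {s A p q m : ℝ} (h : IsReservationValue s A) (hp : p ∈ Ioc 0 A)
    (hq : q ∈ Ioc 0 A) (hpq : p ≤ q) (hm : m * (p + q) = 2 * p * q) (hmA : m ∈ Ioc 0 A)
    (hP : (p, q) ∈ implementablePrices s) : (m, m) ∈ implementablePrices s := by
  have hA1 := h.lt_one
  have hK := le_of_mem_implementablePrices h hp hq hpq hP
  rw [exists_implementable_iff h hp hq] at hP
  rw [diag_mem_iff h hmA]
  obtain ⟨hp0, hpA⟩ := hp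
  obtain ⟨hq0, hqA⟩ := hq
  obtain ⟨hm0, hmA⟩ := hmA
  have hp' : p ∈ Icc (0 : ℝ) 1 := ⟨hp0.le, by linarith⟩
  have hq' : q ∈ Icc (0 : ℝ) 1 := ⟨hq0.le, by linarith⟩
  have hKp : (p - (1 - A)) * (2 + (1 - A)) ≤ (1 + 2 * p - p ^ 2) / 2 := by
    nlinarith [mul_nonneg (sub_nonneg.mpr hpq) (by linarith : 0 ≤ 1 + (1 - A) + (p + q) / 2)]
  obtain ⟨x, hx, he, -⟩ := exists_best_deviation h (p := m) ⟨hm0.le, by linarith⟩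
  have hdp := mul_affine_le_deviationProfit h hp' hx hKp
  have hdq := mul_affine_le_deviationProfit h hq' hx hK
  have hdm : deviationProfit s m ≤ x * (m * (1 - x) + ((1 - x) ^ 2 - (1 - A) ^ 2) / 2) := by
    rw [he]; exact mul_le_mul_of_nonneg_left (secondDemand_le hA1.le) hx.1
  set K := ((1 - x) ^ 2 - (1 - A) ^ 2) / 2
  have hx1 : 0 ≤ x * (1 - x) := mul_nonneg hx.1 (by linarith [hx.2])
  have hσ : 0 < p + q := by linarith
  -- The harmonic mean is at most the geometric one.
  have hmpq : m ^ 2 ≤ p * q := by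
    refine le_of_mul_le_mul_right ?_ (pow_pos hσ 2)
    have : m ^ 2 * (p + q) ^ 2 = (2 * p * q) ^ 2 := by rw [← hm]; ring
    rw [this]
    nlinarith [mul_nonneg (mul_pos hp0 hq0).le (sq_nonneg (p - q))]
  have h₁ : (p + q) * (x * (m * (1 - x) + K)) ≤
      p * (x * (p * (1 - x) + K)) + q * (x * (q * (1 - x) + K)) := by
    have : 0 ≤ x * (1 - x) * (p - q) ^ 2 := mul_nonneg hx1 (sq_nonneg _)
    have e : (p + q) * (x * (m * (1 - x) + K)) =
        x * (1 - x) * (m * (p + q)) + (p + q) * x * K := by ring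
    rw [e, hm]
    linarith
  have h₂ := mul_le_mul_of_nonneg_left hdp hp0.le
  have h₃ := mul_le_mul_of_nonneg_left hdq hq0.le
  have h₄ := mul_le_mul_of_nonneg_left hdm hσ.le
  have h₅ : p * q * (1 - p * q) ≤ p * q * (1 - m ^ 2) :=
    mul_le_mul_of_nonneg_left (by linarith) (mul_pos hp0 hq0).le
  have h₆ : p * q * (1 - m ^ 2) = (p + q) * (m * (1 - m ^ 2) / 2) := by
    have : p * q = m * (p + q) / 2 := by linarith
    rw [this]; ring
  have h₇ : deviationProfit s m ≤ m * (1 - m ^ 2) / 2 := by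
    refine le_of_mul_le_mul_left ?_ hσ
    linarith
  linarith

/-! ### Compactness and the largest symmetric price -/

/-- The price `p` that is the best reply of a second seller to itself is an implementable symmetric
price. It solves `p ^ 2 + 2 * p = 1 - (1 - A) ^ 2`. -/
lemma exists_diag_mem {s A : ℝ} (h : IsReservationValue s A) :
    ∃ p ∈ Ioc 0 A, (p, p) ∈ implementablePrices s := by
  have hA := h.pos
  have hA1 := h.lt_one
  have hsq : √(2 - (1 - A) ^ 2) ^ 2 = 2 - (1 - A) ^ 2 := Real.sq_sqrt (by nlinarith)
  have h1 : 1 < √(2 - (1 - A) ^ 2) := by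
    rw [Real.lt_sqrt (by norm_num)]; nlinarith
  have h2 : √(2 - (1 - A) ^ 2) ≤ 1 + A := by
    rw [Real.sqrt_le_left (by linarith)]; nlinarith
  set p := √(2 - (1 - A) ^ 2) - 1 with hp
  have hpp : p ^ 2 + 2 * p = 1 - (1 - A) ^ 2 := by rw [hp]; linarith
  have hp0 : 0 < p := by linarith
  have hpA : p ∈ Ioc 0 A := ⟨hp0, by linarith⟩
  refine ⟨p, hpA, ?_⟩
  rw [diag_mem_iff h hpA]
  obtain ⟨x, hx, he, -⟩ := exists_best_deviation h (p := p) ⟨hp0.le, by linarith [hpA.2]⟩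
  have hle : x * secondDemand A p x ≤ p ^ 2 := by
    refine (mul_le_mul_of_nonneg_left (secondDemand_le hA1.le) hx.1).trans ?_
    have : 0 ≤ (x - p) ^ 2 * (1 - x / 2) := mul_nonneg (sq_nonneg _) (by linarith [hx.2])
    have e : (1 - A) ^ 2 = 1 - p ^ 2 - 2 * p := by linarith
    rw [e]
    linarith
  rw [he]
  nlinarith [mul_nonneg hp0.le (sq_nonneg (1 - A))]

lemma isCompact_implementable {s A : ℝ} (h : IsReservationValue s A)
    (hP : ∀ c, Implementable s c → c.price₁ ∈ Ioc 0 A ∧ c.price₂ ∈ Ioc 0 A) :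
    IsCompact {t : ℝ × ℝ × ℝ | Implementable s ⟨t.1, t.2.1, t.2.2⟩} := by
  have hA1 := h.lt_one.le
  have hc := continuous_secondDemand A
  have hc₁ : Continuous fun t : ℝ × ℝ × ℝ => secondDemand A t.1 t.2.1 :=
    hc.comp (f := fun t : ℝ × ℝ × ℝ => (t.1, t.2.1)) (by fun_prop)
  have hc₂ : Continuous fun t : ℝ × ℝ × ℝ => secondDemand A t.2.1 t.1 :=
    hc.comp (f := fun t : ℝ × ℝ × ℝ => (t.2.1, t.1)) (by fun_prop)
  have hr : Continuous fun t : ℝ × ℝ × ℝ => rankGain A t.1 t.2.1 := by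
    unfold rankGain; fun_prop
  have heq : {t : ℝ × ℝ × ℝ | Implementable s ⟨t.1, t.2.1, t.2.2⟩} =
      (Icc 0 A ×ˢ Icc 0 A ×ˢ Icc 0 1) ∩ ⋂ x ∈ Icc 0 A,
        ({t : ℝ × ℝ × ℝ | x * secondDemand A t.2.1 x ≤
            t.1 * (secondDemand A t.2.1 t.1 + t.2.2 * rankGain A t.1 t.2.1)} ∩
          {t : ℝ × ℝ × ℝ | x * secondDemand A t.1 x ≤
            t.2.1 * (secondDemand A t.1 t.2.1 + (1 - t.2.2) * rankGain A t.1 t.2.1)}) := by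
    ext ⟨p, q, α⟩
    simp only [mem_ofPred_eq, mem_inter_iff, mem_prod, mem_iInter]
    have hle : ∀ r ∈ Icc 0 A, ∀ t, (∀ x ∈ Icc 0 A, x * secondDemand A r x ≤ t) ↔
        deviationProfit s r ≤ t := by
      intro r hr t
      have hr' : r ∈ Icc (0 : ℝ) 1 := ⟨hr.1, hr.2.trans hA1⟩
      constructor
      · intro ht
        obtain ⟨x, hx, he, -⟩ := exists_best_deviation h hr'
        rw [he]; exact ht x hx
      · exact fun ht x hx => (mul_secondDemand_le_deviationProfit h hr' hx).trans ht
    have key : ∀ (hp : p ∈ Icc 0 A) (hq : q ∈ Icc 0 A), Implementable s ⟨p, q, α⟩ ↔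
        α ∈ Icc (0 : ℝ) 1 ∧ ∀ x ∈ Icc 0 A, x * secondDemand A q x ≤
            p * (secondDemand A q p + α * rankGain A p q) ∧ x * secondDemand A p x ≤
            q * (secondDemand A p q + (1 - α) * rankGain A p q) := by
      intro hp hq
      rw [implementable_iff h ⟨hp.1, hp.2.trans hA1⟩ ⟨hq.1, hq.2.trans hA1⟩, profit₁_eq h hp hq,
        profit₂_eq h hp hq, ← hle q hq, ← hle p hp]
      exact and_congr_right fun _ =>
        ⟨fun ⟨a, b⟩ x hx => ⟨a x hx, b x hx⟩, fun a => ⟨fun x hx => (a x hx).1,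
          fun x hx => (a x hx).2⟩⟩
    constructor
    · intro hc
      obtain ⟨hp, hq⟩ := hP _ hc
      have hp' := Ioc_subset_Icc_self hp
      have hq' := Ioc_subset_Icc_self hq
      have := (key hp' hq').mp hc
      exact ⟨⟨hp', hq', this.1⟩, this.2⟩
    · rintro ⟨⟨hp, hq, hα⟩, hx⟩
      exact (key hp hq).mpr ⟨hα, hx⟩
  rw [heq]
  refine (isCompact_Icc.prod (isCompact_Icc.prod isCompact_Icc)).inter_right ?_
  refine isClosed_iInter fun x => isClosed_iInter fun _ => ?_
  have hx₁ : Continuous fun t : ℝ × ℝ × ℝ => secondDemand A t.1 x :=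
    hc.comp (f := fun t : ℝ × ℝ × ℝ => (t.1, x)) (by fun_prop)
  have hx₂ : Continuous fun t : ℝ × ℝ × ℝ => secondDemand A t.2.1 x :=
    hc.comp (f := fun t : ℝ × ℝ × ℝ => (t.2.1, x)) (by fun_prop)
  exact (isClosed_le (by fun_prop) (by fun_prop)).inter (isClosed_le (by fun_prop) (by fun_prop))

lemma isCompact_implementablePrices {s A : ℝ} (h : IsReservationValue s A)
    (hP : ∀ c, Implementable s c → c.price₁ ∈ Ioc 0 A ∧ c.price₂ ∈ Ioc 0 A) :
    IsCompact (implementablePrices s) := by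
  have := (isCompact_implementable h hP).image
    (f := fun t : ℝ × ℝ × ℝ => (t.1, t.2.1)) (by fun_prop)
  convert this
  ext ⟨p, q⟩
  simp [implementablePrices]

lemma exists_isGreatest_diag {s A : ℝ} (h : IsReservationValue s A)
    (hP : ∀ c, Implementable s c → c.price₁ ∈ Ioc 0 A ∧ c.price₂ ∈ Ioc 0 A) :
    ∃ p, IsGreatest {p : ℝ | (p, p) ∈ implementablePrices s} p := by
  have hclosed : IsClosed {p : ℝ | (p, p) ∈ implementablePrices s} :=
    (isCompact_implementablePrices h hP).isClosed.preimage
      (by fun_prop : Continuous fun p : ℝ => (p, p))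
  have hsub : {p : ℝ | (p, p) ∈ implementablePrices s} ⊆ Icc 0 A :=
    fun p ⟨α, hα⟩ => Ioc_subset_Icc_self (hP _ hα).1
  obtain ⟨p, -, hp⟩ := exists_diag_mem h
  exact (isCompact_Icc.of_isClosed_subset hclosed hsub).exists_isGreatest ⟨p, hp⟩

/-- A point of the closed set `P` that is the last one on the diagonal is a boundary point. -/
lemma isGreatest_frontier {P : Set (ℝ × ℝ)} (hP : IsClosed P) {b : ℝ}
    (hb : IsGreatest {p : ℝ | (p, p) ∈ P} b) : IsGreatest {p : ℝ | (p, p) ∈ frontier P} b := by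
  refine ⟨?_, fun p hp => hb.2 (hP.frontier_subset hp)⟩
  rw [mem_ofPred_eq, hP.frontier_eq]
  refine ⟨hb.1, fun hint => ?_⟩
  have hev : ∀ᶠ p in nhds b, (p, p) ∈ P :=
    (by fun_prop : Continuous fun p : ℝ => (p, p)).continuousAt.eventually
      (mem_interior_iff_mem_nhds.mp hint)
  have hex := (hev.filter_mono nhdsWithin_le_nhds).and
    (self_mem_nhdsWithin : ∀ᶠ p in nhdsWithin b (Ioi b), p ∈ Ioi b)
  obtain ⟨p, hp, hbp⟩ := hex.exists
  exact not_lt.mpr (hb.2 hp) hbp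

/-! ### Symmetric prices -/

lemma sqrt_three_div_sq : (√3 / 3) ^ 2 = 1 / 3 := by
  rw [div_pow, Real.sq_sqrt (by norm_num)]; norm_num

/-- The industry profit at a symmetric price is largest at `√3 / 3`. -/
lemma monopoly_le {p : ℝ} (hp : 0 ≤ p) :
    p * (1 - p ^ 2) ≤ √3 / 3 * (1 - (√3 / 3) ^ 2) := by
  have hr := sqrt_three_div_sq
  have hr0 : 0 ≤ √3 / 3 := by positivity
  set r := √3 / 3
  have : 0 ≤ (p - r) ^ 2 * (p + 2 * r) := by positivity
  have e : p * r ^ 2 = p * (1 / 3) := by rw [hr]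
  have e' : r * r ^ 2 = r * (1 / 3) := by rw [hr]
  linarith

lemma monopoly_lt {p b : ℝ} (hp : 0 ≤ p) (hpb : p < b) (hb : b ≤ √3 / 3) :
    p * (1 - p ^ 2) < b * (1 - b ^ 2) := by
  have hb2 : b ^ 2 ≤ 1 / 3 := by
    rw [← sqrt_three_div_sq]
    exact pow_le_pow_left₀ (hp.trans hpb.le) hb 2
  have : 0 < (b - p) * (1 - b ^ 2 - b * p - p ^ 2) :=
    mul_pos (by linarith) (by nlinarith)
  linarith

/-- The incentive constraints bind at the largest implementable symmetric price, unless that is the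
reservation value. -/
lemma two_mul_deviationProfit_eq {s A b : ℝ} (h : IsReservationValue s A)
    (hb : IsGreatest {p : ℝ | (p, p) ∈ implementablePrices s} b) (hb0 : 0 < b) (hbA : b < A) :
    2 * deviationProfit s b = b * (1 - b ^ 2) := by
  have hA1 := h.lt_one
  refine le_antisymm ((diag_mem_iff h ⟨hb0, hbA.le⟩).mp hb.1) ?_
  by_contra! hlt
  have hev : ∀ᶠ p in nhds b, 2 * deviationProfit s b < b * (1 - p ^ 2) :=
    (by fun_prop : Continuous fun p : ℝ => b * (1 - p ^ 2)).continuousAt.eventually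
      (lt_mem_nhds hlt)
  have hev' := ((hev.and (gt_mem_nhds hbA)).filter_mono nhdsWithin_le_nhds).and
    (self_mem_nhdsWithin : ∀ᶠ p in nhdsWithin b (Ioi b), p ∈ Ioi b)
  obtain ⟨p, ⟨hp, hpA⟩, hbp⟩ := hev'.exists
  change b < p at hbp
  refine not_lt.mpr (hb.2 ?_) hbp
  rw [mem_ofPred_eq, diag_mem_iff h ⟨hb0.trans hbp, hpA.le⟩]
  have hsc := mul_deviationProfit_le h hb0.le hbp.le (by linarith)
  refine le_of_mul_le_mul_left ?_ hb0
  linarith [mul_lt_mul_of_pos_left hp (hb0.trans hbp)]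

/-! ### Low symmetric prices: the symmetric contract is optimal -/

/-- If the largest implementable symmetric price `b` is at most `√3 / 3`, every implementable contract
with different prices earns less than the symmetric one. -/
lemma industryProfit_lt_of_lt {s A b : ℝ} (h : IsReservationValue s A)
    (hP : ∀ c, Implementable s c → c.price₁ ∈ Ioc 0 A ∧ c.price₂ ∈ Ioc 0 A)
    (hb : IsGreatest {p : ℝ | (p, p) ∈ implementablePrices s} b) (hb0 : 0 < b) (hbA : b < A)
    (hbr : b ≤ √3 / 3) {p q α : ℝ} (hc : Implementable s ⟨p, q, α⟩) (hpq : p < q) :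
    industryProfit s ⟨p, q, α⟩ < b * (1 - b ^ 2) := by
  have hA1 := h.lt_one
  obtain ⟨hp, hq⟩ : p ∈ Ioc 0 A ∧ q ∈ Ioc 0 A := hP _ hc
  have hbind := two_mul_deviationProfit_eq h hb hb0 hbA
  have hmem : (p, q) ∈ implementablePrices s := ⟨α, hc⟩
  obtain ⟨hp0, hpA⟩ := hp
  obtain ⟨hq0, hqA⟩ := hq
  have hIC := ((implementable_iff h ⟨hp0.le, by linarith⟩ ⟨hq0.le, by linarith⟩ α).mp hc).2.1
  rw [profit₁_eq h ⟨hp0.le, hpA⟩ ⟨hq0.le, hqA⟩] at hIC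
  rw [industryProfit_eq h ⟨hp0.le, hpA⟩ ⟨hq0.le, hqA⟩]
  set X := secondDemand A q p + α * rankGain A p q
  have hσ : 0 < p + q := by linarith
  rcases le_or_gt b q with hbq | hqb
  -- High prices: compare with the harmonic mean `m`.
  · set m := 2 * p * q / (p + q) with hmdef
    have hm : m * (p + q) = 2 * p * q := by rw [hmdef]; field_simp
    have hm0 : 0 < m := by positivity
    have hmq : m ≤ q := by
      rw [hmdef, div_le_iff₀ hσ]; nlinarith
    have hmb : m ≤ b :=
      hb.2 (harmonicMean_mem h ⟨hp0, hpA⟩ ⟨hq0, hqA⟩ hpq.le hm ⟨hm0, hmq.trans hqA⟩ hmem)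
    have hmono : m * (1 - m ^ 2) ≤ b * (1 - b ^ 2) := by
      rcases hmb.eq_or_lt with he | hlt
      · rw [he]
      · exact (monopoly_lt hm0.le hlt hbr).le
    have hdev := deviationProfit_mono h hb0.le hbq (by linarith)
    have hmpq : m ^ 2 < p * q := by
      refine lt_of_mul_lt_mul_right ?_ (pow_pos hσ 2).le
      have : m ^ 2 * (p + q) ^ 2 = (2 * p * q) ^ 2 := by rw [← hm]; ring
      rw [this]
      nlinarith [mul_pos (mul_pos hp0 hq0) (pow_pos (sub_pos.mpr hpq) 2)]
    -- The cheaper seller sells at least the fraction `q / (p + q)` of `1 - m ^ 2` units.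
    have hX : q * (1 - m ^ 2) ≤ (p + q) * X := by
      have : m * (1 - m ^ 2) ≤ 2 * (p * X) := by linarith
      have h₁ := mul_le_mul_of_nonneg_left this hσ.le
      have e : (p + q) * (m * (1 - m ^ 2)) = 2 * p * q * (1 - m ^ 2) := by rw [← hm]; ring
      rw [e] at h₁
      refine le_of_mul_le_mul_left ?_ (by positivity : 0 < 2 * p)
      linarith
    refine lt_of_lt_of_le ?_ hmono
    refine lt_of_mul_lt_mul_left ?_ hσ.le
    have e : (p + q) * (m * (1 - m ^ 2)) = 2 * p * q * (1 - m ^ 2) := by rw [← hm]; ring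
    rw [e]
    have h₁ := mul_le_mul_of_nonneg_left hX (sub_pos.mpr hpq).le
    have h₂ := mul_lt_mul_of_pos_left hmpq (mul_pos hq0 hσ)
    linarith
  -- Low prices: compare with the symmetric price `q`.
  · have hlt := monopoly_lt hq0.le hqb hbr
    refine lt_of_le_of_lt ?_ hlt
    have hsc := mul_deviationProfit_le h hq0.le hqb.le (by linarith)
    have hb2 : b ^ 2 ≤ 1 / 3 := by
      rw [← sqrt_three_div_sq]
      exact pow_le_pow_left₀ hb0.le hbr 2
    have hdev : q * b ^ 2 ≤ deviationProfit s q := by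
      refine le_of_mul_le_mul_left ?_ hb0
      nlinarith [mul_nonneg (mul_pos hq0 hb0).le (sub_nonneg.mpr hb2)]
    have hX : q ^ 2 ≤ X := by
      refine le_of_mul_le_mul_left ?_ hp0
      have e₁ : q * q ^ 2 ≤ q * b ^ 2 :=
        mul_le_mul_of_nonneg_left (pow_le_pow_left₀ hq0.le hqb.le 2) hq0.le
      have e₂ : p * q ^ 2 ≤ q * q ^ 2 := mul_le_mul_of_nonneg_right hpq.le (sq_nonneg q)
      linarith
    nlinarith [mul_le_mul_of_nonneg_left hX (sub_pos.mpr hpq).le]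

lemma industryProfit_diag {s A p : ℝ} (h : IsReservationValue s A) (hp : p ∈ Icc 0 A) (α : ℝ) :
    industryProfit s ⟨p, p, α⟩ = p * (1 - p ^ 2) := by
  rw [industryProfit_eq h hp hp]; ring

/-- If the largest implementable symmetric price is at most `√3 / 3`, it is optimal; the probability is
`1 / 2` because both incentive constraints bind. -/
lemma isSellerOptimal_iff_of_le {s A b : ℝ} (h : IsReservationValue s A)
    (hP : ∀ c, Implementable s c → c.price₁ ∈ Ioc 0 A ∧ c.price₂ ∈ Ioc 0 A)
    (hb : IsGreatest {p : ℝ | (p, p) ∈ implementablePrices s} b) (hA : √3 / 3 < A)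
    (hbr : b ≤ √3 / 3) (c : Contract) : IsSellerOptimal s c ↔ c = ⟨b, b, 1 / 2⟩ := by
  have hA1 := h.lt_one
  have hbI : b ∈ Ioc 0 A := by
    obtain ⟨α, hα⟩ := hb.1
    exact (hP _ hα).1
  have hbA : b < A := hbr.trans_lt hA
  have hbind := two_mul_deviationProfit_eq h hb hbI.1 hbA
  have hbI' := Ioc_subset_Icc_self hbI
  have hΔ : 0 < rankGain A b b := rankGain_pos hA1
  have hsum : 2 * secondDemand A b b = 1 - b ^ 2 - rankGain A b b := by rw [rankGain]; ring
  have hb1 : b ∈ Icc (0 : ℝ) 1 := ⟨hbI.1.le, by linarith⟩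
  have himp : ∀ α, Implementable s ⟨b, b, α⟩ ↔ α = 1 / 2 := by
    intro α
    rw [implementable_iff h hb1 hb1, profit₁_eq h hbI' hbI', profit₂_eq h hbI' hbI']
    have e₁ : b * (secondDemand A b b + α * rankGain A b b) =
        deviationProfit s b + (α - 1 / 2) * (b * rankGain A b b) := by
      linear_combination (b / 2) * hsum - hbind / 2
    have e₂ : b * (secondDemand A b b + (1 - α) * rankGain A b b) =
        deviationProfit s b + (1 / 2 - α) * (b * rankGain A b b) := by
      linear_combination (b / 2) * hsum - hbind / 2
    have hpos : 0 < b * rankGain A b b := mul_pos hbI.1 hΔ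
    rw [e₁, e₂]
    constructor
    · rintro ⟨-, h₁, h₂⟩
      have h₃ := nonneg_of_mul_nonneg_left (by linarith : 0 ≤ (α - 1 / 2) * _) hpos
      have h₄ := nonneg_of_mul_nonneg_left (by linarith : 0 ≤ (1 / 2 - α) * _) hpos
      linarith
    · rintro rfl
      norm_num
  have hopt : ∀ d, Implementable s d →
      industryProfit s d < b * (1 - b ^ 2) ∨ d = ⟨b, b, 1 / 2⟩ := by
    rintro ⟨p, q, α⟩ hd
    rcases lt_trichotomy p q with hlt | rfl | hlt
    · exact Or.inl (industryProfit_lt_of_lt h hP hb hbI.1 hbA hbr hd hlt)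
    · have hp : p ∈ Ioc 0 A := (hP _ hd).1
      have hpb : p ≤ b := hb.2 ⟨α, hd⟩
      rcases hpb.eq_or_lt with rfl | hpb
      · exact Or.inr (by rw [(himp α).mp hd])
      · rw [industryProfit_diag h (Ioc_subset_Icc_self hp)]
        exact Or.inl (monopoly_lt hp.1.le hpb hbr)
    · rw [← industryProfit_swap]
      exact Or.inl (industryProfit_lt_of_lt h hP hb hbI.1 hbA hbr hd.swap hlt)
  have hval : industryProfit s ⟨b, b, 1 / 2⟩ = b * (1 - b ^ 2) := industryProfit_diag h hbI' _
  constructor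
  · rintro ⟨hc, hmax⟩
    refine (hopt c hc).resolve_left (not_lt.mpr ?_)
    rw [← hval]
    exact hmax _ ((himp _).mpr rfl)
  · rintro rfl
    refine ⟨(himp _).mpr rfl, fun d hd => ?_⟩
    rw [hval]
    rcases hopt d hd with hlt | rfl
    · exact hlt.le
    · rw [hval]

/-! ### High symmetric prices: optimal contracts are asymmetric -/

lemma exists_isSellerOptimal {s A : ℝ} (h : IsReservationValue s A)
    (hP : ∀ c, Implementable s c → c.price₁ ∈ Ioc 0 A ∧ c.price₂ ∈ Ioc 0 A) :
    ∃ c, IsSellerOptimal s c := by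
  have hc := continuous_secondDemand A
  have hc₁ : Continuous fun t : ℝ × ℝ × ℝ => secondDemand A t.1 t.2.1 :=
    hc.comp (f := fun t : ℝ × ℝ × ℝ => (t.1, t.2.1)) (by fun_prop)
  have hc₂ : Continuous fun t : ℝ × ℝ × ℝ => secondDemand A t.2.1 t.1 :=
    hc.comp (f := fun t : ℝ × ℝ × ℝ => (t.2.1, t.1)) (by fun_prop)
  have hr : Continuous fun t : ℝ × ℝ × ℝ => rankGain A t.1 t.2.1 := by
    unfold rankGain; fun_prop
  have hcont : ContinuousOn (fun t : ℝ × ℝ × ℝ => industryProfit s ⟨t.1, t.2.1, t.2.2⟩)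
      {t : ℝ × ℝ × ℝ | Implementable s ⟨t.1, t.2.1, t.2.2⟩} := by
    refine ContinuousOn.congr (f := fun t : ℝ × ℝ × ℝ => t.2.1 * (1 - t.1 * t.2.1) -
      (t.2.1 - t.1) * (secondDemand A t.2.1 t.1 + t.2.2 * rankGain A t.1 t.2.1))
      (by fun_prop) fun t ht => ?_
    exact industryProfit_eq h (Ioc_subset_Icc_self (hP _ ht).1) (Ioc_subset_Icc_self (hP _ ht).2) _
  obtain ⟨p, -, α, hα⟩ := exists_diag_mem h
  obtain ⟨t, ht, hmax⟩ := (isCompact_implementable h hP).exists_isMaxOn ⟨(p, p, α), hα⟩ hcont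
  exact ⟨⟨t.1, t.2.1, t.2.2⟩, ht, fun d hd => hmax (a := (d.price₁, d.price₂, d.prob)) hd⟩

/-- Spreading the prices around `√3 / 3` allows one to rank the more expensive seller first more
often, which is a gain of first order. -/
lemma exists_implementable_gt {s A b : ℝ} (h : IsReservationValue s A)
    (hb : (b, b) ∈ implementablePrices s) (hbA : b ∈ Ioc 0 A) (hbr : √3 / 3 < b) :
    ∃ c, Implementable s c ∧ √3 / 3 * (1 - (√3 / 3) ^ 2) < industryProfit s c := by
  have hA1 := h.lt_one
  have hr0 : 0 < √3 / 3 := by positivity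
  have hr2 := sqrt_three_div_sq
  set r := √3 / 3
  have hrA : r < A := hbr.trans_le hbA.2
  set μ := deviationProfit s r with hμ
  have hμ0 : 0 < μ := deviationProfit_pos h ⟨hr0.le, by linarith⟩
  have hμlt : 2 * μ < r * (1 - r ^ 2) := by
    have h₁ := deviationProfit_mono h hr0.le hbr.le (by linarith [hbA.2])
    have h₂ := (diag_mem_iff h hbA).mp hb
    have h₃ : b * (1 - b ^ 2) < r * (1 - r ^ 2) := by
      have : 0 < (b - r) ^ 2 * (b + 2 * r) := by
        have := sub_pos.mpr hbr
        have := hbA.1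
        positivity
      have e : b * r ^ 2 = b * (1 / 3) := by rw [hr2]
      have e' : r * r ^ 2 = r * (1 / 3) := by rw [hr2]
      linarith
    linarith
  have ev₁ : ∀ᶠ ε in nhds (0 : ℝ), r * ((r - ε) * μ) + (r + ε) * ((r + ε) * μ) <
      r * ((r - ε) * (r + ε) * (1 - (r - ε) * (r + ε))) := by
    refine ContinuousAt.eventually_lt (by fun_prop) (by fun_prop) ?_
    nlinarith [mul_lt_mul_of_pos_left hμlt (mul_pos hr0 hr0)]
  have ev₂ : ∀ᶠ ε in nhds (0 : ℝ), 2 * ((r + ε) * μ) < r * ((r - ε) * (1 - r ^ 2)) := by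
    refine ContinuousAt.eventually_lt (by fun_prop) (by fun_prop) ?_
    nlinarith [mul_lt_mul_of_pos_left hμlt hr0]
  have ev₃ : ∀ᶠ ε in nhds (0 : ℝ), ε < r ∧ ε < A - r :=
    (gt_mem_nhds hr0).and (gt_mem_nhds (by linarith))
  have hev := ((ev₁.and (ev₂.and ev₃)).filter_mono nhdsWithin_le_nhds).and
    (self_mem_nhdsWithin : ∀ᶠ ε in nhdsWithin (0 : ℝ) (Ioi 0), ε ∈ Ioi 0)
  obtain ⟨ε, ⟨h₁, h₂, hεr, hεA⟩, hε⟩ := hev.exists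
  change 0 < ε at hε
  have hp : r - ε ∈ Ioc 0 A := ⟨by linarith, by linarith⟩
  have hq : r + ε ∈ Ioc 0 A := ⟨by linarith, by linarith⟩
  have hdp := deviationProfit_mono h hp.1.le (by linarith : r - ε ≤ r) (by linarith)
  have hdq := mul_deviationProfit_le h hr0.le (by linarith : r ≤ r + ε) (by linarith)
  rw [← hμ] at hdp hdq
  obtain ⟨α, hα, hbind⟩ := exists_implementable_of_le h hp hq (by
    refine le_of_mul_le_mul_left ?_ hr0
    have e₁ := mul_le_mul_of_nonneg_left hdp (mul_pos hr0 hp.1).le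
    have e₂ := mul_le_mul_of_nonneg_left hdq hq.1.le
    linarith)
  refine ⟨_, hα, ?_⟩
  rw [profit₁_eq h (Ioc_subset_Icc_self hp) (Ioc_subset_Icc_self hq)] at hbind
  rw [industryProfit_eq h (Ioc_subset_Icc_self hp) (Ioc_subset_Icc_self hq)]
  set X := secondDemand A (r + ε) (r - ε) + α * rankGain A (r - ε) (r + ε)
  have hX : 2 * X < 1 - r ^ 2 := by
    refine lt_of_mul_lt_mul_left ?_ (mul_pos hr0 hp.1).le
    rw [← hbind] at hdq
    linarith
  have h₃ := mul_lt_mul_of_pos_left hX hε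
  have h₄ : 0 < (r + ε) * ε ^ 2 := mul_pos hq.1 (pow_pos hε 2)
  linarith

/-- When each seller is ranked first with probability `1 / 2`, the industry profit is at most that
at the mean of the two prices. -/
lemma industryProfit_half_le {s A p q : ℝ} (h : IsReservationValue s A) (hp : p ∈ Icc 0 A)
    (hq : q ∈ Icc 0 A) (hpq : p ≤ q) : industryProfit s ⟨p, q, 1 / 2⟩ ≤
      (p + q) / 2 * (1 - ((p + q) / 2) ^ 2) := by
  have hA1 := h.lt_one
  rw [industryProfit_eq h hp hq, rankGain, secondDemand_of_sub_le (p := p) (x := q) (by linarith)]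
  have hp0 := hp.1
  have hqA := hq.2
  rcases le_total (q - (1 - A)) p with hle | hle
  · rw [secondDemand_of_sub_le hle]
    have : 0 ≤ (q - p) ^ 2 * (8 - 3 * (p + q)) := mul_nonneg (sq_nonneg _) (by linarith)
    linarith
  · rw [secondDemand_of_le_sub hle]
    have e₁ : 0 ≤ (q - p) ^ 2 * (4 - 3 * ((p + q) / 2) - (q - p)) :=
      mul_nonneg (sq_nonneg _) (by linarith)
    have e₂ : 0 ≤ (q - p) * (1 - A) ^ 2 := mul_nonneg (by linarith) (sq_nonneg _)
    linarith

lemma IsSellerOptimal.asymmetric {s A b : ℝ} (h : IsReservationValue s A)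
    (hP : ∀ c, Implementable s c → c.price₁ ∈ Ioc 0 A ∧ c.price₂ ∈ Ioc 0 A)
    (hb : (b, b) ∈ implementablePrices s) (hbr : √3 / 3 < b) {c : Contract}
    (hc : IsSellerOptimal s c) : c.price₁ ≠ c.price₂ ∧ c.prob ≠ 1 / 2 := by
  obtain ⟨α, hα⟩ := hb
  obtain ⟨d, hd, hgt⟩ := exists_implementable_gt h ⟨α, hα⟩ (hP _ hα).1 hbr
  have hlt := hgt.trans_le (hc.2 d hd)
  obtain ⟨hp, hq⟩ := hP c hc.1
  obtain ⟨p, q, β⟩ := c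
  have hp' := Ioc_subset_Icc_self hp
  have hq' := Ioc_subset_Icc_self hq
  refine ⟨?_, ?_⟩ <;> simp only at hp' hq' ⊢ <;> rintro rfl <;> refine not_le.mpr hlt ?_
  · rw [industryProfit_diag h hp']
    exact monopoly_le hp'.1
  · refine le_trans ?_ (monopoly_le (p := (p + q) / 2) (by linarith [hp'.1, hq'.1]))
    rcases le_total p q with hpq | hpq
    · exact industryProfit_half_le h hp' hq' hpq
    · have := industryProfit_half_le h hq' hp' hpq
      have e : Contract.swap ⟨p, q, 1 / 2⟩ = ⟨q, p, 1 / 2⟩ := by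
        simp only [Contract.swap]; norm_num
      rw [← industryProfit_swap, e, add_comm p q]
      exact this

/-! ### The first best -/

lemma industryProfit_eq_combination (s p q α : ℝ) : industryProfit s ⟨p, q, α⟩ =
    α * industryProfit s ⟨p, q, 1⟩ + (1 - α) * industryProfit s ⟨q, p, 1⟩ := by
  simp only [industryProfit, profit₁, profit₂]; ring

lemma industryProfit_one (s p q : ℝ) :
    industryProfit s ⟨p, q, 1⟩ = p * demandFirst s p q + q * demandSecond s p q := by
  simp only [industryProfit, profit₁, profit₂]; ring

lemma industryProfit_one_eq {s A p q : ℝ} (h : IsReservationValue s A) (hp : p ∈ Icc (0 : ℝ) 1)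
    (hq : q ∈ Icc 0 A) : industryProfit s ⟨p, q, 1⟩ =
      p * (1 - p * q) + (q - p) * secondDemand A p q := by
  have hA1 := h.lt_one.le
  have h₁ := demandFirst_add_demandSecond h.cost_pos h.value_eq hp ⟨hq.1, hq.2.trans hA1⟩ hq.2
  rw [industryProfit_one, eq_sub_of_add_eq h₁, demandSecond_eq h.cost_pos h.value_eq hA1 hp hq]
  ring

/-- Prices outside `[0, 1]` for the first seller and outside `[0, A]` for the second one are never
better than suitable prices inside. -/
lemma exists_industryProfit_one_ge {s A : ℝ} (h : IsReservationValue s A) (p q : ℝ) :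
    ∃ p' ∈ Icc (0 : ℝ) 1, ∃ q' ∈ Icc 0 A,
      industryProfit s ⟨p, q, 1⟩ ≤ industryProfit s ⟨p', q', 1⟩ := by
  have hA := h.pos
  have hA1 := h.lt_one
  have hzero : industryProfit s ⟨p, q, 1⟩ ≤ 0 → ∃ p' ∈ Icc (0 : ℝ) 1, ∃ q' ∈ Icc 0 A,
      industryProfit s ⟨p, q, 1⟩ ≤ industryProfit s ⟨p', q', 1⟩ := fun hle =>
    ⟨0, by norm_num, 0, ⟨le_rfl, hA.le⟩, by rw [industryProfit_one s 0 0]; simpa using hle⟩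
  -- If the first seller earns at least the whole profit, the second one may charge `A`.
  have hmono : industryProfit s ⟨p, q, 1⟩ ≤ p * demandFirst s p q →
      ∃ p' ∈ Icc (0 : ℝ) 1, ∃ q' ∈ Icc 0 A,
      industryProfit s ⟨p, q, 1⟩ ≤ industryProfit s ⟨p', q', 1⟩ := by
    intro hle
    rcases lt_or_ge p 0 with hp0 | hp0
    · exact hzero (hle.trans (mul_nonpos_of_nonpos_of_nonneg hp0.le (demandFirst_nonneg _ _ _)))
    rcases lt_or_ge 1 p with hp1 | hp1
    · exact hzero (hle.trans (by rw [demandFirst_of_one_le s q hp1.le, mul_zero]))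
    refine ⟨p, ⟨hp0, hp1⟩, A, ⟨hA.le, le_rfl⟩, hle.trans ?_⟩
    rw [industryProfit_one_eq h ⟨hp0, hp1⟩ ⟨hA.le, le_rfl⟩, secondDemand_of_sub_le (by linarith)]
    have h₁ := mul_le_mul_of_nonneg_left (demandFirst_le s q ⟨hp0, hp1⟩) hp0
    have h₂ : 0 ≤ A * p * (1 - A) := mul_nonneg (mul_nonneg hA.le hp0) (by linarith)
    linarith
  rcases lt_or_ge A q with hqA | hqA
  · refine hmono ?_
    rw [industryProfit_one, demandSecond_of_lt h.cost_pos h.value_eq hqA]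
    linarith
  rcases lt_or_ge q 0 with hq0 | hq0
  · refine hmono ?_
    rw [industryProfit_one]
    linarith [mul_nonpos_of_nonpos_of_nonneg hq0.le (demandSecond_nonneg s p q)]
  have hqI : q ∈ Icc (0 : ℝ) 1 := ⟨hq0, by linarith⟩
  have hsym : p * demandFirst s p q ≤ 0 → ∃ p' ∈ Icc (0 : ℝ) 1, ∃ q' ∈ Icc 0 A,
      industryProfit s ⟨p, q, 1⟩ ≤ industryProfit s ⟨p', q', 1⟩ := by
    intro hle
    refine ⟨q, hqI, q, ⟨hq0, hqA⟩, ?_⟩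
    rw [industryProfit_one_eq h hqI ⟨hq0, hqA⟩, industryProfit_one]
    have h₁ := mul_le_mul_of_nonneg_left (demandSecond_le s p hqI) hq0
    have h₂ : 0 ≤ q * (q * (1 - q)) := mul_nonneg hq0 (mul_nonneg hq0 (by linarith))
    linarith
  rcases lt_or_ge p 0 with hp0 | hp0
  · exact hsym (mul_nonpos_of_nonpos_of_nonneg hp0.le (demandFirst_nonneg _ _ _))
  rcases lt_or_ge 1 p with hp1 | hp1
  · exact hsym (by rw [demandFirst_of_one_le s q hp1.le, mul_zero])
  exact ⟨p, ⟨hp0, hp1⟩, q, ⟨hq0, hqA⟩, le_rfl⟩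

lemma exists_isFirstBest {s A : ℝ} (h : IsReservationValue s A) : ∃ c, IsFirstBest s c := by
  have hc : Continuous fun t : ℝ × ℝ => secondDemand A t.1 t.2 := continuous_secondDemand A
  have hcont : ContinuousOn (fun t : ℝ × ℝ => industryProfit s ⟨t.1, t.2, 1⟩)
      (Icc 0 1 ×ˢ Icc 0 A) := by
    refine ContinuousOn.congr (f := fun t : ℝ × ℝ => t.1 * (1 - t.1 * t.2) +
      (t.2 - t.1) * secondDemand A t.1 t.2) (by fun_prop) fun t ht => ?_
    exact industryProfit_one_eq h ht.1 ht.2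
  obtain ⟨t, -, hmax⟩ := (isCompact_Icc.prod isCompact_Icc).exists_isMaxOn
    ⟨((0 : ℝ), (0 : ℝ)), ⟨le_rfl, zero_le_one⟩, ⟨le_rfl, h.pos.le⟩⟩ hcont
  have hle : ∀ p q, industryProfit s ⟨p, q, 1⟩ ≤ industryProfit s ⟨t.1, t.2, 1⟩ := by
    intro p q
    obtain ⟨p', hp', q', hq', hle⟩ := exists_industryProfit_one_ge h p q
    exact hle.trans (hmax (a := (p', q')) ⟨hp', hq'⟩)
  refine ⟨⟨t.1, t.2, 1⟩, by norm_num, fun d hd => ?_⟩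
  obtain ⟨p, q, α⟩ := d
  obtain ⟨hα0, hα1⟩ : α ∈ Icc (0 : ℝ) 1 := hd
  rw [industryProfit_eq_combination]
  have h₁ := mul_le_mul_of_nonneg_left (hle p q) hα0
  have h₂ := mul_le_mul_of_nonneg_left (hle q p) (sub_nonneg.mpr hα1)
  linarith

/-- A first-order condition at an end of an interval: if `ε * k ε ≤ 0` for small `ε > 0`, then
`k 0 ≤ 0`. -/
lemma nonpos_of_forall_mul_nonpos {k : ℝ → ℝ} (hk : Continuous k) {δ : ℝ} (hδ : 0 < δ)
    (h : ∀ ε, 0 < ε → ε < δ → ε * k ε ≤ 0) : k 0 ≤ 0 := by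
  refine le_of_tendsto (hk.continuousAt.mono_left (nhdsWithin_le_nhds (s := Ioi 0))) ?_
  filter_upwards [Ioo_mem_nhdsGT hδ] with ε hε
  exact nonpos_of_mul_nonpos_right (h ε hε.1 hε.2) hε.1

/-- The price `q` of the second seller cannot be optimal both for that seller and for the industry:
an increase of `q` benefits the first seller. -/
lemma not_both_optimal {A p q : ℝ} (hA1 : A < 1) (hp : p ∈ Ioc 0 A) (hq : q ∈ Ioc 0 A)
    (hdev : ∀ x ∈ Icc 0 A, x * secondDemand A p x ≤ q * secondDemand A p q)
    (hind : ∀ x ∈ Icc 0 A, p * (1 - p * x) + (x - p) * secondDemand A p x ≤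
      p * (1 - p * q) + (q - p) * secondDemand A p q) : False := by
  obtain ⟨hp0, hpA⟩ := hp
  obtain ⟨hq0, hqA⟩ := hq
  rcases lt_or_ge q (p - (1 - A)) with hlt | hge
  -- Every consumer goes on: increase `q` for the industry, decrease it for the seller.
  · have hD := secondDemand_of_le_sub hlt.le
    set D := secondDemand A p q
    have h₁ := nonpos_of_forall_mul_nonpos (k := fun ε => q - D - ε) (by fun_prop) hq0
      fun ε hε hεq => by
        have := hdev (q - ε) ⟨by linarith, by linarith⟩
        rw [secondDemand_of_le_sub (by linarith)] at this
        rw [hD] at this ⊢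
        linarith
    have h₂ := nonpos_of_forall_mul_nonpos (k := fun ε => -p ^ 2 + D - (q - p) - ε) (by fun_prop)
      (sub_pos.mpr hlt) fun ε hε hεq => by
        have := hind (q + ε) ⟨by linarith, by linarith⟩
        rw [secondDemand_of_le_sub (by linarith)] at this
        rw [hD] at this ⊢
        linarith
    have : 0 < p * (1 - p) := mul_pos hp0 (by linarith)
    linarith
  · have hD := secondDemand_of_sub_le hge
    set D := secondDemand A p q
    have hright (hqA : q < A) : -p ^ 2 + D - (q - p) * (p + 1 - q) ≤ 0 := by
      have := nonpos_of_forall_mul_nonpos (k := fun ε => -p ^ 2 + D +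
        (q - p) * (-(p + 1 - q) + ε / 2) + ε * (-(p + 1 - q) + ε / 2)) (by fun_prop)
        (sub_pos.mpr hqA) fun ε hε hεq => by
          have := hind (q + ε) ⟨by linarith, by linarith⟩
          rw [secondDemand_of_sub_le (by linarith)] at this
          rw [hD] at this ⊢
          linarith
      linarith
    rcases hge.eq_or_lt with heq | hgt
    -- At the kink, the industry profit alone has a profitable change of `q`.
    · have h₁ := hright (by linarith)
      have hD' := secondDemand_of_le_sub heq.ge
      have h₂ := nonpos_of_forall_mul_nonpos (k := fun ε => p ^ 2 - D + (q - p) - ε) (by fun_prop)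
        hq0 fun ε hε hεq => by
          have := hind (q - ε) ⟨by linarith, by linarith⟩
          rw [secondDemand_of_le_sub (by linarith)] at this
          change _ ≤ _ + (q - p) * D at this
          change D = _ at hD'
          rw [hD'] at this ⊢
          linarith
      have : 0 < (p - q) ^ 2 := by
        have : 0 < p - q := by linarith
        positivity
      linarith
    · have h₁ : -D + q * (p + 1 - q) ≤ 0 := by
        have := nonpos_of_forall_mul_nonpos (k := fun ε => -D + q * (p + 1 - q) + ε * q / 2 -
          ε * (p + 1 - q) - ε ^ 2 / 2) (by fun_prop)
          (lt_min hq0 (sub_pos.mpr hgt)) fun ε hε hεq => by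
            obtain ⟨hε₁, hε₂⟩ := lt_min_iff.mp hεq
            have := hdev (q - ε) ⟨by linarith, by linarith⟩
            rw [secondDemand_of_sub_le (by linarith)] at this
            rw [hD] at this ⊢
            linarith
        linarith
      rcases hqA.eq_or_lt with rfl | hqA
      · nlinarith [mul_pos hq0 hp0, mul_nonneg (sub_nonneg.mpr hpA) (sub_pos.mpr hA1).le]
      · have h₂ := hright hqA
        have : 0 < p * (1 - q) := mul_pos hp0 (by linarith)
        linarith

lemma IsFirstBest.swap {s : ℝ} {c : Contract} (hc : IsFirstBest s c) : IsFirstBest s c.swap := by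
  obtain ⟨⟨h0, h1⟩, hmax⟩ := hc
  refine ⟨⟨?_, ?_⟩, fun d hd => ?_⟩
  · simp only [Contract.swap]; linarith
  · simp only [Contract.swap]; linarith
  · rw [industryProfit_swap]; exact hmax d hd

/-- A small increase of the price of the seller ranked first, and an equal decrease of the other
price, is profitable, as the seller ranked first has the larger demand. -/
lemma not_isFirstBest_diag {s A : ℝ} (h : IsReservationValue s A) {p α : ℝ} (hp : p ∈ Ioc 0 A) :
    ¬ IsFirstBest s ⟨p, p, α⟩ := by
  intro hc
  have hA1 := h.lt_one
  obtain ⟨hp0, hpA⟩ := hp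
  have hk := nonpos_of_forall_mul_nonpos (k := fun ε => (1 - p ^ 2) + ε * p + ε ^ 2 -
    2 * ((p + ε) * (1 - (p - ε)) + ((1 - (p - ε)) ^ 2 - (1 - A) ^ 2) / 2)) (by fun_prop)
    (lt_min hp0 (half_pos (sub_pos.mpr hA1))) fun ε hε hεp => by
      obtain ⟨hε₁, hε₂⟩ := lt_min_iff.mp hεp
      have := hc.2 ⟨p + ε, p - ε, 1⟩ (by norm_num)
      rw [industryProfit_diag h ⟨hp0.le, hpA⟩, industryProfit_one_eq h ⟨by linarith, by linarith⟩
        ⟨by linarith, by linarith⟩, secondDemand_of_sub_le (by linarith)] at this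
      linarith
  have : 0 < (1 - A) ^ 2 := pow_pos (by linarith) 2
  linarith

lemma IsFirstBest.not_implementable_of_prob_eq_one {s A : ℝ} (h : IsReservationValue s A)
    {p q : ℝ} (hp : p ∈ Ioc 0 A) (hq : q ∈ Ioc 0 A) (hfb : IsFirstBest s ⟨p, q, 1⟩) :
    ¬ Implementable s ⟨p, q, 1⟩ := by
  intro hc
  have hA1 := h.lt_one
  have hp' : p ∈ Icc (0 : ℝ) 1 := ⟨hp.1.le, by linarith [hp.2]⟩
  have hq' := Ioc_subset_Icc_self hq
  refine not_both_optimal hA1 hp hq (fun x hx => ?_) fun x hx => ?_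
  · have h₁ := ((implementable_iff h hp' ⟨hq.1.le, by linarith [hq.2]⟩ 1).mp hc).2.2
    rw [profit₂_eq h (Ioc_subset_Icc_self hp) hq', sub_self, zero_mul, add_zero] at h₁
    exact (mul_secondDemand_le_deviationProfit h hp' hx).trans h₁
  · have h₁ := hfb.2 ⟨p, x, 1⟩ (by norm_num)
    rwa [industryProfit_one_eq h hp' hx, industryProfit_one_eq h hp' hq'] at h₁

lemma IsFirstBest.not_implementable {s A : ℝ} (h : IsReservationValue s A)
    (hP : ∀ c, Implementable s c → c.price₁ ∈ Ioc 0 A ∧ c.price₂ ∈ Ioc 0 A) {c : Contract}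
    (hfb : IsFirstBest s c) : ¬ Implementable s c := by
  intro hc
  have hA1 := h.lt_one
  obtain ⟨hp, hq⟩ := hP c hc
  obtain ⟨p, q, α⟩ := c
  simp only at hp hq
  have hne : p ≠ q := by
    rintro rfl
    exact not_isFirstBest_diag h hp hfb
  obtain ⟨hα0, hα1⟩ : α ∈ Icc (0 : ℝ) 1 := hfb.1
  rcases hα0.eq_or_lt with rfl | hα0
  · have e : Contract.swap ⟨p, q, 0⟩ = ⟨q, p, 1⟩ := by simp [Contract.swap]
    exact IsFirstBest.not_implementable_of_prob_eq_one h hq hp (e ▸ hfb.swap) (e ▸ hc.swap)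
  rcases hα1.eq_or_lt with rfl | hα1
  · exact IsFirstBest.not_implementable_of_prob_eq_one h hp hq hfb hc
  · -- The industry profit is affine in the probability, hence constant, which forces equal prices.
    have h₁ := hfb.2 ⟨p, q, 1⟩ (by norm_num)
    have h₀ := hfb.2 ⟨p, q, 0⟩ (by norm_num)
    have hp' := Ioc_subset_Icc_self hp
    have hq' := Ioc_subset_Icc_self hq
    have hΔ : 0 < rankGain A p q := rankGain_pos hA1
    simp only [industryProfit_eq h hp' hq'] at h₁ h₀
    have e₁ : 0 ≤ (q - p) * rankGain A p q :=
      nonneg_of_mul_nonneg_right (a := 1 - α) (by linarith) (by linarith)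
    have e₀ : 0 ≤ -((q - p) * rankGain A p q) :=
      nonneg_of_mul_nonneg_right (a := α) (by linarith) hα0
    have e : (q - p) * rankGain A p q = 0 := le_antisymm (by linarith) e₁
    rcases mul_eq_zero.mp e with h' | h'
    · exact hne (by linarith)
    · exact hΔ.ne' h'

end OrderedSearch

theorem theorem1 :
    (∃ s₀ : ℝ, 0 < s₀ ∧ ∀ s : ℝ, 0 < s → s < s₀ → Nondegenerate s) ∧
    ∀ s : ℝ, 0 < s → Nondegenerate s →
      ∃ pbar : ℝ, IsGreatest {p : ℝ | (p, p) ∈ frontier (implementablePrices s)} pbar ∧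
        (pbar ≤ Real.sqrt 3 / 3 →
          ∀ c : Contract, IsSellerOptimal s c ↔ c = ⟨pbar, pbar, 1 / 2⟩) ∧
        (Real.sqrt 3 / 3 < pbar →
          (∃ c : Contract, IsSellerOptimal s c) ∧
          ∀ c : Contract, IsSellerOptimal s c → c.price₁ ≠ c.price₂ ∧ c.prob ≠ 1 / 2) ∧
        (∃ c : Contract, IsFirstBest s c) ∧
        (∀ c : Contract, IsFirstBest s c → ¬ Implementable s c) := by
  refine ⟨⟨1 / 2048, by norm_num, fun s hs hs' => nondegenerate_of_lt hs hs'⟩, fun s hs hn => ?_⟩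
  obtain ⟨A, h, hA, hP⟩ := hn.exists_reservationValue hs
  obtain ⟨b, hb⟩ := exists_isGreatest_diag h hP
  exact ⟨b, isGreatest_frontier (isCompact_implementablePrices h hP).isClosed hb,
    isSellerOptimal_iff_of_le h hP hb hA,
    fun hbr => ⟨exists_isSellerOptimal h hP, fun c hc => hc.asymmetric h hP hb.1 hbr⟩,
    exists_isFirstBest h, fun c hc => hc.not_implementable h hP⟩
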